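/- **Setting.** A finite probability space is a set with a probability measure supported on a finite set; its atoms are the points of positive weight, $|X|$ is the number of atoms of $X$, and $x\in X$ means that $x$ is an atom. Morphisms are measure-preserving maps up to equality on a set of full measure. Entropies use the natural logarithm, and for a morphism $Z\to X$ the number $[Z|X]=\sum_{x\in X}p_X(x)\,\mathrm{Ent}(Z|x)$ is the relative entropy. An indexing category $\mathbf G$ is a finite poset category with least common ancestors ($i$ is an ancestor of $j$, and $j$ a descendant of $i$, if there is a morphism $i\to j$); it then has an initial object. We write $|\mathbf G|$ for its number of objects. A $\mathbf G$-diagram is a functor from $\mathbf G$ to finite probability spaces; it is homogeneous if its automorphism group acts transitively on the atoms of each of its spaces. For a space $X$ in a diagram, $\lceil X\rceil$ is the sub-diagram of all descendants of $X$ (including $X$), and for an atom $u$ of a space $U$ in the diagram, $\lceil X\rceil|u$ is $\lceil X\rceil$ with every space carrying its conditional distribution given $u$. A fan $X\leftarrow Z\to U$ is minimal if every morphism $Z\to W$ over $X$ and $U$ to the source of another fan $X\leftarrow W\to U$ is an isomorphism. It is an admissible fan in a diagram if it is a minimal fan of spaces of the diagram, $Z$ is the initial space of the diagram, and every space of the diagram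 is a descendant of $X$ or an ancestor of $U$. For $\mathbf H$-diagrams $\mathcal X,\mathcal Y$ the intrinsic entropy distance $\mathbf k(\mathcal X,\mathcal Y)$ is the infimum, over all two-fans $\mathcal X\leftarrow\mathcal W\to\mathcal Y$ of $\mathbf H$-diagrams, of $\sum_i|\mathrm{Ent}(W_i)-\mathrm{Ent}(X_i)|+\sum_i|\mathrm{Ent}(W_i)-\mathrm{Ent}(Y_i)|$. The asymptotic entropy distance is $\boldsymbol\kappa(\mathcal X,\mathcal Y)=\lim_{n\to\infty}\frac1n\mathbf k(\mathcal X^{n},\mathcal Y^{n})$, where $\mathcal X^{n}$ is the $n$-th tensor power (independent product). **Proposition.** Let $\mathbf G$ be an indexing category, and let $X_0\leftarrow Z_0\to U$ be an admissible fan in a homogeneous $\mathbf G$-diagram $\mathcal Z$ of finite probability spaces, with $|X_0|\ge 3$. Then there is a $\mathbf G$-diagram $\mathcal Z'$ in which the fan $X_0'\leftarrow Z_0'\to U'$, at the same places of $\mathbf G$ as the original fan, is admissible, such that with $\mathcal X=\lceil X_0\rceil$ and $\mathcal X'=\lceil X_0'\rceil$: 1. $\mathcal X|u\cong\mathcal X'|u'$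 for all atoms $u\in U$ and $u'\in U'$; 2. the limit $\boldsymbol\kappa(\mathcal X,\mathcal X')$ exists and $\boldsymbol\kappa(\mathcal X,\mathcal X')\le\mathbf k(\mathcal X,\mathcal X')\le 20\,|\mathbf G|$; 3. $[Z_0'|X_0']\le 4\ln\ln|X_0|$. -/

import Mathlib

open CategoryTheory

universe u v

/-- A finite probability space: a set with a probability measure supported on a finite set. -/
structure FinProb where
  carrier : Type v
  pmf : PMF carrier
  finite_support : pmf.support.Finite

namespace FinProb

/-- The atoms of `X`, that is, the points of positive weight. -/
@[ext] structure Atom (X : FinProb.{v}) : Type v where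
  val : X.carrier
  mem : val ∈ X.pmf.support

/-- Atoms are the elements of the support. -/
def atomEquiv (X : FinProb.{v}) : X.pmf.support ≃ X.Atom where
  toFun x := ⟨x.1, x.2⟩
  invFun x := ⟨x.val, x.mem⟩

noncomputable instance (X : FinProb.{v}) : Fintype X.Atom :=
  letI := X.finite_support.fintype
  Fintype.ofEquiv _ X.atomEquiv

/-- The weight of an atom. -/
noncomputable def w (X : FinProb.{v}) (x : X.Atom) : ℝ := (X.pmf x.val).toReal

theorem w_pos (X : FinProb.{v}) (x : X.Atom) : 0 < X.w x :=
  ENNReal.toReal_pos ((PMF.mem_support_iff _ _).1 x.mem) (X.pmf.apply_ne_top _)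

theorem sum_w (X : FinProb.{v}) : ∑ x, X.w x = 1 := by
  have h : ∑ x : X.Atom, X.pmf x.val = 1 := by
    rw [← tsum_fintype (L := SummationFilter.unconditional _),
      ← X.atomEquiv.tsum_eq (fun x : X.Atom => X.pmf x.val)]
    have h1 : (∑' x : X.pmf.support, X.pmf x.1) = ∑' x, X.pmf x := tsum_subtype_support _
    rw [X.pmf.tsum_coe] at h1
    exact h1
  simp only [w]
  rw [← ENNReal.toReal_sum (fun x _ => X.pmf.apply_ne_top _), h]
  simp

open Classical in
/-- A morphism of finite probability spaces: an equivalence class of measure-preserving maps,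
two maps being equivalent if they agree on a set of full measure. Such a class is the same thing
as a map between the sets of atoms which pushes the weights forward to the weights. -/
@[ext] structure Hom (X Y : FinProb.{v}) where
  toFun : X.Atom → Y.Atom
  push : ∀ y, ∑ x with toFun x = y, X.w x = Y.w y

open Classical in
noncomputable instance : Category FinProb.{v} where
  Hom X Y := Hom X Y
  id X := ⟨fun x => x, fun y => by simp [Finset.sum_filter]⟩
  comp {X Y Z} f g := ⟨fun x => g.toFun (f.toFun x), fun z => by
    rw [← g.push z, Finset.sum_congr rfl (fun y _ => (f.push y).symm)]
    simp only [Finset.sum_filter]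
    simp_rw [← Finset.sum_filter (fun y => g.toFun y = z), Finset.sum_filter]
    have : ∀ y, (if g.toFun y = z then ∑ x, (if f.toFun x = y then X.w x else 0) else 0)
        = ∑ x, if f.toFun x = y then (if g.toFun (f.toFun x) = z then X.w x else 0) else 0 := by
      intro y
      split_ifs with h
      · refine Finset.sum_congr rfl fun x _ => ?_
        by_cases hx : f.toFun x = y <;> simp [hx, h]
      · symm
        refine Finset.sum_eq_zero fun x _ => ?_
        by_cases hx : f.toFun x = y <;> simp [hx, h]
    rw [Finset.sum_congr rfl (fun y _ => this y), Finset.sum_comm]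
    simp⟩

/-- The action of a morphism on atoms. -/
def app {X Y : FinProb.{v}} (f : X ⟶ Y) : X.Atom → Y.Atom := Hom.toFun f

open Classical in
theorem app_push {X Y : FinProb.{v}} (f : X ⟶ Y) (y : Y.Atom) :
    ∑ x with app f x = y, X.w x = Y.w y := Hom.push f y

theorem hom_ext {X Y : FinProb.{v}} {f g : X ⟶ Y} (h : ∀ x, app f x = app g x) : f = g :=
  Hom.ext (funext h)

@[simp] theorem app_id (X : FinProb.{v}) (x : X.Atom) : app (𝟙 X) x = x := rfl

@[simp] theorem app_comp {X Y Z : FinProb.{v}} (f : X ⟶ Y) (g : Y ⟶ Z) (x : X.Atom) :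
    app (f ≫ g) x = app g (app f x) := rfl

/-- The entropy `-∑ p ln p` (natural logarithm). -/
noncomputable def ent (X : FinProb.{v}) : ℝ := ∑ x, Real.negMulLog (X.w x)

open Classical in
/-- The relative entropy `[X|Y]` for a reduction `f : X ⟶ Y`: the mean over `y` of the entropy of
the fibre of `X` over `y` with its conditional distribution. -/
noncomputable def condEnt {X Y : FinProb.{v}} (f : X ⟶ Y) : ℝ :=
  ∑ y, Y.w y * ∑ x with app f x = y, Real.negMulLog (X.w x / Y.w y)

/-- The probability space on a finite set given by non-negative weights with total mass one. -/
noncomputable def ofWeights {α : Type v} [Fintype α] (p : α → ℝ) (h0 : ∀ a, 0 ≤ p a)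
    (h1 : ∑ a, p a = 1) : FinProb.{v} where
  carrier := α
  pmf := PMF.ofFintype (fun a => ENNReal.ofReal (p a)) (by
    rw [← ENNReal.ofReal_sum_of_nonneg (fun a _ => h0 a), h1, ENNReal.ofReal_one])
  finite_support := Set.toFinite _

section ofWeights
variable {α β γ : Type v} [Fintype α] [Fintype β] [Fintype γ]

/-- An atom of `ofWeights p` as an element of the underlying finite set. -/
def pt {p : α → ℝ} {h0 : ∀ a, 0 ≤ p a} {h1 : ∑ a, p a = 1} (x : (ofWeights p h0 h1).Atom) : α :=
  x.val

theorem pt_ext {p : α → ℝ} {h0 : ∀ a, 0 ≤ p a} {h1 : ∑ a, p a = 1}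
    {x y : (ofWeights p h0 h1).Atom} (h : pt x = pt y) : x = y := Atom.ext h

theorem w_ofWeights (p : α → ℝ) (h0 : ∀ a, 0 ≤ p a) (h1 : ∑ a, p a = 1)
    (x : (ofWeights p h0 h1).Atom) : (ofWeights p h0 h1).w x = p (pt x) := by
  simp only [w, ofWeights]
  erw [PMF.ofFintype_apply]
  exact ENNReal.toReal_ofReal (h0 _)

theorem mem_ofWeights (p : α → ℝ) (h0 : ∀ a, 0 ≤ p a) (h1 : ∑ a, p a = 1) (a : α) :
    a ∈ (ofWeights p h0 h1).pmf.support ↔ 0 < p a := by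
  simp only [ofWeights]
  erw [PMF.mem_support_iff, PMF.ofFintype_apply]
  simp

open Classical in
theorem sum_atom_ofWeights (p : α → ℝ) (h0 : ∀ a, 0 ≤ p a) (h1 : ∑ a, p a = 1)
    (P : α → Prop) :
    ∑ x : (ofWeights p h0 h1).Atom with P (pt x), (ofWeights p h0 h1).w x
      = ∑ a with P a, p a := by
  refine Finset.sum_of_injOn (fun x : (ofWeights p h0 h1).Atom => pt x)
    (fun x _ y _ h => Atom.ext h) ?_ ?_ ?_
  · intro x hx
    exact Finset.mem_coe.2 (Finset.mem_filter.2 ⟨Finset.mem_univ _,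
      (Finset.mem_filter.1 (Finset.mem_coe.1 hx)).2⟩)
  · intro a ha hna
    by_contra hne
    apply hna
    have hm : a ∈ (ofWeights p h0 h1).pmf.support :=
      (mem_ofWeights p h0 h1 a).2 (lt_of_le_of_ne (h0 a) (Ne.symm hne))
    exact ⟨⟨a, hm⟩, Finset.mem_coe.2 (Finset.mem_filter.2 ⟨Finset.mem_univ _,
      (Finset.mem_filter.1 ha).2⟩), rfl⟩
  · intro x _; exact w_ofWeights p h0 h1 x

open Classical in
/-- A map of finite sets that pushes weights forward induces a morphism of the spaces. -/
noncomputable def homOfWeights {p : α → ℝ} {h0 : ∀ a, 0 ≤ p a} {h1 : ∑ a, p a = 1}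
    {q : β → ℝ} {k0 : ∀ a, 0 ≤ q a} {k1 : ∑ a, q a = 1} (f : α → β)
    (hf : ∀ b, ∑ a with f a = b, p a = q b) :
    ofWeights p h0 h1 ⟶ ofWeights q k0 k1 :=
  Hom.mk (X := ofWeights p h0 h1) (Y := ofWeights q k0 k1)
    (fun x => ⟨f (pt x), (mem_ofWeights q k0 k1 _).2 (by
      rw [← hf]
      exact lt_of_lt_of_le ((mem_ofWeights p h0 h1 _).1 x.mem)
        (Finset.single_le_sum (f := p) (fun a _ => h0 a)
          (Finset.mem_filter.2 ⟨Finset.mem_univ _, rfl⟩)))⟩)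
    (fun y => by
      have h := sum_atom_ofWeights p h0 h1 (fun a => f a = pt y)
      rw [w_ofWeights]
      refine Eq.trans ?_ (h.trans (hf (pt y)))
      refine Finset.sum_congr ?_ fun _ _ => rfl
      ext x
      simp only [Finset.mem_filter, Finset.mem_univ, true_and]
      exact Atom.ext_iff)

open Classical in
theorem pt_homOfWeights {p : α → ℝ} {h0 : ∀ a, 0 ≤ p a} {h1 : ∑ a, p a = 1}
    {q : β → ℝ} {k0 : ∀ a, 0 ≤ q a} {k1 : ∑ a, q a = 1} (f : α → β)
    (hf : ∀ b, ∑ a with f a = b, p a = q b) (x : (ofWeights p h0 h1).Atom) :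
    pt (app (homOfWeights (k0 := k0) (k1 := k1) f hf) x) = f (pt x) := rfl

end ofWeights

end FinProb

/-- The fan `i ← k → j` is minimal: whenever `k ⟶ l` is a morphism over `i` and `j` to the source
of another fan `i ← l → j`, it is an isomorphism. -/
def IsMinimalFan {C : Type*} [Category C] {i j k : C} (f : k ⟶ i) (g : k ⟶ j) : Prop :=
  ∀ (l : C) (a : l ⟶ i) (b : l ⟶ j) (h : k ⟶ l), h ≫ a = f → h ≫ b = g → IsIso h

/- An indexing category is a finite poset category with least common ancestors. With a morphism
`i ⟶ j` for `i ≤ j`, the ancestors of `j` are the elements below it, the least common ancestor of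
two objects is their infimum, and the initial object is `⊥`. A diagram is a functor to `FinProb`. -/
namespace ProbDiag

section basic
variable {H : Type u} [Preorder H]

theorem app_map_id (X : H ⥤ FinProb.{v}) (i : H) (x : (X.obj i).Atom) :
    FinProb.app (X.map (𝟙 i)) x = x := by
  rw [X.map_id, FinProb.app_id]

theorem app_map_comp (X : H ⥤ FinProb.{v}) {i j k : H} (f : i ⟶ j) (g : j ⟶ k)
    (x : (X.obj i).Atom) :
    FinProb.app (X.map (f ≫ g)) x = FinProb.app (X.map g) (FinProb.app (X.map f) x) := by
  rw [X.map_comp, FinProb.app_comp]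

/-- The entropy distance `‖ent Z - ent X‖₁ + ‖ent Z - ent Y‖₁` between the terminal diagrams of a
fan `X ← Z → Y` of diagrams. -/
noncomputable def fanDist [Finite H] {X Y Z : H ⥤ FinProb.{v}} (_f : Z ⟶ X) (_g : Z ⟶ Y) : ℝ :=
  (∑ᶠ i, |(Z.obj i).ent - (X.obj i).ent|) + ∑ᶠ i, |(Z.obj i).ent - (Y.obj i).ent|

/-- The intrinsic entropy distance: the infimum of the entropy distance over all fans `X ← Z → Y`
of diagrams. (The tensor product shows that such fans exist, and the distances are non-negative,
so this is a genuine infimum; see `exists_fan`.) -/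
noncomputable def ikd [Finite H] (X Y : H ⥤ FinProb.{v}) : ℝ :=
  sInf {r | ∃ (Z : H ⥤ FinProb.{v}) (f : Z ⟶ X) (g : Z ⟶ Y), r = fanDist f g}

open Classical in
theorem prod_push {A B C D : FinProb.{v}} (f : A ⟶ C) (g : B ⟶ D) (b : C.Atom × D.Atom) :
    ∑ a : A.Atom × B.Atom with Prod.map (FinProb.app f) (FinProb.app g) a = b,
      A.w a.1 * B.w a.2 = C.w b.1 * D.w b.2 := by
  rw [← FinProb.app_push f, ← FinProb.app_push g, Finset.sum_mul_sum, ← Finset.sum_product']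
  refine Finset.sum_congr ?_ fun _ _ => rfl
  ext a
  simp [Prod.ext_iff]

theorem tensor_nonneg (A B : FinProb.{v}) (a : A.Atom × B.Atom) : 0 ≤ A.w a.1 * B.w a.2 :=
  mul_nonneg (A.w_pos _).le (B.w_pos _).le

theorem tensor_sum (A B : FinProb.{v}) : ∑ a : A.Atom × B.Atom, A.w a.1 * B.w a.2 = 1 := by
  rw [Fintype.sum_prod_type, ← Finset.sum_mul_sum, A.sum_w, B.sum_w, one_mul]

/-- The independent product of two finite probability spaces. -/
noncomputable def tensorSpace (A B : FinProb.{v}) : FinProb.{v} :=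
  FinProb.ofWeights (fun a : A.Atom × B.Atom => A.w a.1 * B.w a.2)
    (tensor_nonneg A B) (tensor_sum A B)

/-- The tensor product of two diagrams. -/
noncomputable def tensor (X Y : H ⥤ FinProb.{v}) : H ⥤ FinProb.{v} where
  obj i := tensorSpace (X.obj i) (Y.obj i)
  map h := FinProb.homOfWeights (Prod.map (FinProb.app (X.map h)) (FinProb.app (Y.map h)))
    (fun b => by rw [← prod_push]; congr!)
  map_id i := FinProb.hom_ext fun x => FinProb.pt_ext (
    Prod.ext (app_map_id X i _) (app_map_id Y i _))
  map_comp f g := FinProb.hom_ext fun x => FinProb.pt_ext (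
    Prod.ext (app_map_comp X f g _) (app_map_comp Y f g _))

/-- The projection of a tensor product to its first factor. -/
noncomputable def tensorFst (X Y : H ⥤ FinProb.{v}) : tensor X Y ⟶ X where
  app i := FinProb.Hom.mk (X := tensorSpace (X.obj i) (Y.obj i)) (fun x => (FinProb.pt x).1) (fun y => by
    classical
    refine (FinProb.sum_atom_ofWeights _ (tensor_nonneg _ _) (tensor_sum _ _)
      (fun a : (X.obj i).Atom × (Y.obj i).Atom => a.1 = y)).trans ?_
    · rw [Finset.sum_filter, Fintype.sum_prod_type]
      simp [← Finset.mul_sum, FinProb.sum_w])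
  naturality i j h := rfl

/-- The projection of a tensor product to its second factor. -/
noncomputable def tensorSnd (X Y : H ⥤ FinProb.{v}) : tensor X Y ⟶ Y where
  app i := FinProb.Hom.mk (X := tensorSpace (X.obj i) (Y.obj i)) (fun x => (FinProb.pt x).2) (fun y => by
    classical
    refine (FinProb.sum_atom_ofWeights _ (tensor_nonneg _ _) (tensor_sum _ _)
      (fun a : (X.obj i).Atom × (Y.obj i).Atom => a.2 = y)).trans ?_
    · rw [Finset.sum_filter, Fintype.sum_prod_type]
      simp [← Finset.sum_mul, FinProb.sum_w])
  naturality i j h := rfl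

theorem exists_fan [Finite H] (X Y : H ⥤ FinProb.{v}) :
    {r | ∃ (Z : H ⥤ FinProb.{v}) (f : Z ⟶ X) (g : Z ⟶ Y), r = fanDist f g}.Nonempty :=
  ⟨_, tensor X Y, tensorFst X Y, tensorSnd X Y, rfl⟩

open Classical in
theorem pow_push {A B : FinProb.{v}} (n : ℕ) (f : A ⟶ B) (b : Fin n → B.Atom) :
    ∑ a : Fin n → A.Atom with (fun k => FinProb.app f (a k)) = b, ∏ k, A.w (a k)
      = ∏ k, B.w (b k) := by
  simp_rw [← FinProb.app_push f]
  rw [Finset.prod_univ_sum]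
  refine Finset.sum_congr ?_ fun _ _ => rfl
  ext a
  simp [funext_iff]

/-- The `n`-th tensor power of a finite probability space: independent samples of length `n`. -/
noncomputable def powSpace (n : ℕ) (A : FinProb.{v}) : FinProb.{v} :=
  FinProb.ofWeights (fun a : Fin n → A.Atom => ∏ k, A.w (a k))
    (fun a => Finset.prod_nonneg fun k _ => (A.w_pos _).le)
    (by
      classical
      have h := Finset.prod_univ_sum (fun _ : Fin n => (Finset.univ : Finset A.Atom))
        (fun _ a => A.w a)
      simp only [A.sum_w, Finset.prod_const_one, Fintype.piFinset_univ] at h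
      exact h.symm)

/-- The `n`-th tensor power of a diagram. -/
noncomputable def pow (X : H ⥤ FinProb.{v}) (n : ℕ) : H ⥤ FinProb.{v} where
  obj i := powSpace n (X.obj i)
  map h := FinProb.homOfWeights (fun a k => FinProb.app (X.map h) (a k))
    (fun b => by rw [← pow_push]; congr!)
  map_id i := FinProb.hom_ext fun x => FinProb.pt_ext (
    funext fun _ => app_map_id X i _)
  map_comp f g := FinProb.hom_ext fun x => FinProb.pt_ext (
    funext fun _ => app_map_comp X f g _)

/-- `d` is the asymptotic entropy distance `lim (1/n) ikd(Xⁿ, Yⁿ)` of `X` and `Y`. -/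
def IsAikd [Finite H] (X Y : H ⥤ FinProb.{v}) (d : ℝ) : Prop :=
  Filter.Tendsto (fun n : ℕ => ikd (pow X n) (pow Y n) / n) Filter.atTop (nhds d)

/-- A diagram is homogeneous if its automorphism group acts transitively on every space in it. -/
def IsHomogeneous (Z : H ⥤ FinProb.{v}) : Prop :=
  ∀ (i : H) (a b : (Z.obj i).Atom), ∃ φ : Aut Z, FinProb.app (φ.hom.app i) a = b

/-- The sub-diagram `⌈X_x⌉` formed by the descendants of `x`. -/
noncomputable def ideal (Z : H ⥤ FinProb.{v}) (x : H) : {i : H // x ≤ i} ⥤ FinProb.{v} :=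
  (Subtype.mono_coe (fun i => x ≤ i)).functor ⋙ Z

end basic

section indexing
variable {G : Type u} [SemilatticeInf G] [OrderBot G]

/-- The map from the initial space of a diagram to one of its spaces, on atoms. -/
def fromInit (Z : G ⥤ FinProb.{v}) (i : G) : (Z.obj ⊥).Atom → (Z.obj i).Atom :=
  FinProb.app (Z.map (homOfLE (bot_le : ⊥ ≤ i)))

theorem fromInit_map (Z : G ⥤ FinProb.{v}) {i j : G} (h : i ⟶ j) (z : (Z.obj ⊥).Atom) :
    FinProb.app (Z.map h) (fromInit Z i z) = fromInit Z j z := by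
  rw [fromInit, fromInit, ← FinProb.app_comp, ← Functor.map_comp]
  rfl

open Classical in
/-- The conditional probability of the atom `y` of `Z_i` given the atom `a` of `Z_u`, with respect
to the joint distribution given by the initial space of `Z`. -/
noncomputable def condWeight (Z : G ⥤ FinProb.{v}) {u : G} (a : (Z.obj u).Atom) (i : G)
    (y : (Z.obj i).Atom) : ℝ :=
  (∑ z with fromInit Z i z = y ∧ fromInit Z u z = a, (Z.obj ⊥).w z) / (Z.obj u).w a

theorem condWeight_nonneg (Z : G ⥤ FinProb.{v}) {u : G} (a : (Z.obj u).Atom) (i : G)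
    (y : (Z.obj i).Atom) : 0 ≤ condWeight Z a i y :=
  div_nonneg (Finset.sum_nonneg fun _ _ => (FinProb.w_pos _ _).le) (FinProb.w_pos _ _).le

theorem sum_condWeight (Z : G ⥤ FinProb.{v}) {u : G} (a : (Z.obj u).Atom) (i : G) :
    ∑ y, condWeight Z a i y = 1 := by
  classical
  simp only [condWeight, ← Finset.sum_div]
  rw [div_eq_one_iff_eq (FinProb.w_pos _ _).ne', ← FinProb.app_push (Z.map (homOfLE (bot_le : ⊥ ≤ u))) a,
    Finset.sum_filter]
  change _ = ∑ z, if fromInit Z u z = a then _ else _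
  simp only [Finset.sum_filter]
  rw [Finset.sum_comm]
  refine Finset.sum_congr rfl fun z _ => ?_
  by_cases h : fromInit Z u z = a
  · simp [h]
  · simp [h]

open Classical in
theorem condWeight_push (Z : G ⥤ FinProb.{v}) {u : G} (a : (Z.obj u).Atom) {i j : G}
    (h : i ⟶ j) (b : (Z.obj j).Atom) :
    ∑ y with FinProb.app (Z.map h) y = b, condWeight Z a i y = condWeight Z a j b := by
  simp only [condWeight, ← Finset.sum_div]
  congr 1
  simp only [Finset.sum_filter]
  simp_rw [← Finset.sum_filter (fun y => FinProb.app (Z.map h) y = b), Finset.sum_filter]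
  have : ∀ y, (if FinProb.app (Z.map h) y = b then
      ∑ z, (if fromInit Z i z = y ∧ fromInit Z u z = a then (Z.obj ⊥).w z else 0) else 0)
      = ∑ z, if fromInit Z i z = y then
        (if fromInit Z j z = b ∧ fromInit Z u z = a then (Z.obj ⊥).w z else 0) else 0 := by
    intro y
    split_ifs with hy
    · refine Finset.sum_congr rfl fun z _ => ?_
      by_cases hz : fromInit Z i z = y
      · simp [hz, ← fromInit_map Z h z, hy]
      · simp [hz]
    · symm
      refine Finset.sum_eq_zero fun z _ => ?_
      by_cases hz : fromInit Z i z = y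
      · simp [hz, ← fromInit_map Z h z, hy]
      · simp [hz]
  rw [Finset.sum_congr rfl (fun y _ => this y), Finset.sum_comm]
  simp

/-- The conditioned diagram `Z|a`, where `a` is an atom of the space `Z_u` in `Z`: every space of
`Z` carries its conditional distribution given `a`. -/
noncomputable def cond (Z : G ⥤ FinProb.{v}) {u : G} (a : (Z.obj u).Atom) : G ⥤ FinProb.{v} where
  obj i := FinProb.ofWeights (condWeight Z a i) (condWeight_nonneg Z a i) (sum_condWeight Z a i)
  map h := FinProb.homOfWeights (FinProb.app (Z.map h))
    (fun b => by rw [← condWeight_push])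
  map_id i := FinProb.hom_ext fun x => FinProb.pt_ext (app_map_id Z i _)
  map_comp f g := FinProb.hom_ext fun x => FinProb.pt_ext (app_map_comp Z f g _)

/-- The spaces `X ← Z → U` at `x`, `⊥` and `u` form an admissible fan in the diagram `Z`: the
space at `⊥` is initial, the fan is minimal, and every space in the diagram is a descendant of
`X` or an ancestor of `U`. -/
structure IsAdmissibleFan (Z : G ⥤ FinProb.{v}) (x u : G) : Prop where
  minimal : IsMinimalFan (Z.map (homOfLE (bot_le : ⊥ ≤ x))) (Z.map (homOfLE (bot_le : ⊥ ≤ u)))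
  cover : ∀ i, x ≤ i ∨ i ≤ u

end indexing

end ProbDiag

/-! The space `U` is replaced by a short random sample of its atoms. Choose a sequence `s` of `N`
atoms of `U`. Let `n` be a uniform index, and let `z` be an atom of the initial space distributed
conditionally on lying over `s n`. In the new diagram `contract`, spaces above `U` carry the index
together with the image of `z`, and the others only the image of `z`.

If `X` is not an ancestor of `U`, no descendant of `X` carries the index. Conditioning on an index
`n` then gives `⌈X⌉` conditioned on `s n`. Homogeneity makes all these conditioned diagrams
isomorphic, which is claim 1. If `X` is an ancestor of `U`, minimality makes `Z₀ ⟶ X` an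
isomorphism, and the original diagram serves.

Homogeneity makes all spaces uniform, so every atom of `X` is incident to the same proportion `q =
|Z₀| / (|X| |U|)` of the atoms of `U`. Write `L = ln |X|`. A Chernoff bound with a union bound over
`X` (`exists_sample`) gives a sample with `N q` of order `L ^ 3` when `L` is large, in which no atom
of `X` is hit more than `(1 + ε) N q` times, with `ε = 9 / L`. Two consequences follow.

The fibre of the new initial space over an atom of `X` embeds in the set of indices hitting it. Its
size is at most `L ^ 4`, so its entropy is at most `4 ln L`.

With `t = 1 / (1 + ε)`, the new distribution on `X` times `t` is dominated by the old one. The old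
diagram is thus a mixture of the new one and a remainder of mass `1 - t`. Coupling through this
mixture (`ikd_le_of_excess_nonneg`) costs at most `2 (1 + (1 - t) L) ≤ 20` per space. The asymptotic
distance exists and is bounded by the intrinsic one by Fekete's lemma. -/

namespace FinProb

/-! ### Morphisms on atoms and minimal fans -/

theorem sum_filter_congr {α : Type*} [Fintype α] {P Q : α → Prop}
    {_ : DecidablePred P} {_ : DecidablePred Q} (h : ∀ a, P a ↔ Q a) (w : α → ℝ) :
    ∑ a with P a, w a = ∑ a with Q a, w a := by
  refine Finset.sum_congr ?_ fun _ _ => rfl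
  ext a
  simp [h]

theorem sum_filter_fiberwise {α β : Type*} [Fintype α] [Fintype β] [DecidableEq β] (g : α → β)
    (P : β → Prop) [DecidablePred P] [DecidablePred fun a => P (g a)] (w : α → ℝ) :
    ∑ b with P b, ∑ a with g a = b, w a = ∑ a with P (g a), w a := by
  rw [← Finset.sum_fiberwise_of_maps_to (s := Finset.univ.filter fun a => P (g a))
    (t := Finset.univ.filter P) (g := g) (by simp)]
  refine Finset.sum_congr rfl fun b hb => Finset.sum_congr ?_ fun _ _ => rfl
  ext a
  have := (Finset.mem_filter.1 hb).2
  simp only [Finset.mem_filter, Finset.mem_univ, true_and]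
  exact ⟨fun h => ⟨h ▸ this, h⟩, fun h => h.2⟩

theorem app_surjective {X Y : FinProb.{v}} (f : X ⟶ Y) : Function.Surjective (app f) := by
  classical
  intro y
  by_contra h
  push Not at h
  have h1 := app_push f y
  rw [Finset.sum_eq_zero] at h1
  · exact (Y.w_pos y).ne h1
  · intro x hx
    exact absurd (Finset.mem_filter.1 hx).2 (h x)

theorem card_atom_le {X Y : FinProb.{v}} (f : X ⟶ Y) :
    Fintype.card Y.Atom ≤ Fintype.card X.Atom :=
  Fintype.card_le_of_surjective _ (app_surjective f)

theorem atom_nonempty (X : FinProb.{v}) : Nonempty X.Atom := by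
  by_contra h
  rw [not_nonempty_iff] at h
  have := X.sum_w
  simp at this

theorem w_app_of_injective {X Y : FinProb.{v}} (f : X ⟶ Y) (hf : Function.Injective (app f))
    (x : X.Atom) : Y.w (app f x) = X.w x := by
  classical
  rw [← app_push f, Finset.sum_eq_single_of_mem x (by simp)]
  intro b hb hne
  exact absurd (hf (Finset.mem_filter.1 hb).2) hne

/-- Atoms have positive weight, so every morphism is already surjective on atoms; injectivity makes
it a weight-preserving bijection. -/
theorem isIso_of_injective {X Y : FinProb.{v}} (f : X ⟶ Y) (hf : Function.Injective (app f)) :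
    IsIso f := by
  classical
  let e := Equiv.ofBijective (app f) ⟨hf, app_surjective f⟩
  have he : ∀ x, e x = app f x := fun _ => rfl
  refine ⟨Hom.mk (X := Y) (Y := X) e.symm fun x => ?_, hom_ext fun x => ?_, hom_ext fun y => ?_⟩
  · rw [← w_app_of_injective f hf, Finset.sum_eq_single_of_mem (app f x)]
    · simp [← he]
    · intro b hb hne
      refine absurd ?_ hne
      rw [← (Finset.mem_filter.1 hb).2, ← he, e.apply_symm_apply]
  · exact e.symm_apply_apply x
  · exact e.apply_symm_apply y

theorem injective_of_isIso {X Y : FinProb.{v}} (f : X ⟶ Y) [IsIso f] :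
    Function.Injective (app f) := by
  intro a b h
  have h1 : ∀ x, app (inv f) (app f x) = x := fun x => by
    rw [← app_comp, IsIso.hom_inv_id, app_id]
  rw [← h1 a, h, h1]

theorem isMinimalFan_of_injective {X U Z : FinProb.{v}} (f : Z ⟶ X) (g : Z ⟶ U)
    (h : ∀ a b, app f a = app f b → app g a = app g b → a = b) : IsMinimalFan f g := by
  intro l a b k hf hg
  refine isIso_of_injective k fun z z' hz => h z z' ?_ ?_
  · rw [← hf, app_comp, app_comp, hz]
  · rw [← hg, app_comp, app_comp, hz]

section ofWeights
variable {α : Type v} [Fintype α]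

theorem sum_atom (p : α → ℝ) (h0 : ∀ a, 0 ≤ p a) (h1 : ∑ a, p a = 1) (g : α → ℝ)
    (hg : ∀ a, p a = 0 → g a = 0) :
    ∑ x : (ofWeights p h0 h1).Atom, g (pt x) = ∑ a, g a := by
  refine Finset.sum_of_injOn (fun x : (ofWeights p h0 h1).Atom => pt x)
    (fun x _ y _ h => Atom.ext h) (fun x _ => by simp) ?_ (fun _ _ => rfl)
  intro a _ hna
  apply hg
  by_contra hne
  apply hna
  have hm : a ∈ (ofWeights p h0 h1).pmf.support :=
    (mem_ofWeights p h0 h1 a).2 (lt_of_le_of_ne (h0 a) (Ne.symm hne))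
  exact ⟨⟨a, hm⟩, by simp, rfl⟩

theorem pt_pos {p : α → ℝ} {h0 : ∀ a, 0 ≤ p a} {h1 : ∑ a, p a = 1}
    (x : (ofWeights p h0 h1).Atom) : 0 < p (pt x) := by
  rw [← w_ofWeights p h0 h1]; exact w_pos _ _

theorem exists_pt_eq {p : α → ℝ} {h0 : ∀ a, 0 ≤ p a} {h1 : ∑ a, p a = 1} {a : α}
    (ha : 0 < p a) : ∃ x : (ofWeights p h0 h1).Atom, pt x = a :=
  ⟨⟨a, (mem_ofWeights p h0 h1 a).2 ha⟩, rfl⟩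

theorem ent_ofWeights (p : α → ℝ) (h0 : ∀ a, 0 ≤ p a) (h1 : ∑ a, p a = 1) :
    (ofWeights p h0 h1).ent = ∑ a, Real.negMulLog (p a) := by
  rw [ent, ← sum_atom p h0 h1 (fun a => Real.negMulLog (p a)) (fun a ha => by simp [ha])]
  simp_rw [w_ofWeights]

open Classical in
/-- A map out of a space given by weights, defined on the underlying set, is a morphism if it
pushes the weights forward. -/
noncomputable def homOfPush {p : α → ℝ} {h0 : ∀ a, 0 ≤ p a} {h1 : ∑ a, p a = 1}
    {Y : FinProb.{v}} (f : α → Y.Atom) (hf : ∀ y, ∑ a with f a = y, p a = Y.w y) :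
    ofWeights p h0 h1 ⟶ Y :=
  Hom.mk (X := ofWeights p h0 h1) (fun x => f (pt x))
    (fun y => by rw [← hf, ← sum_atom_ofWeights p h0 h1 (fun a => f a = y)])

end ofWeights

-- Minimality is tested against the joint distribution of `X` and `U` on the product of their atoms,
-- through which the fan factors. Together with `isMinimalFan_of_injective`, this reduces minimality
-- to joint injectivity on atoms.
open Classical in
theorem injective_of_isMinimalFan {X U Z : FinProb.{v}} {f : Z ⟶ X} {g : Z ⟶ U}
    (h : IsMinimalFan f g) {a b : Z.Atom} (hf : app f a = app f b) (hg : app g a = app g b) :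
    a = b := by
  let p : X.Atom × U.Atom → ℝ := fun c => ∑ z with (app f z, app g z) = c, Z.w z
  have p0 : ∀ c, 0 ≤ p c := fun c => Finset.sum_nonneg fun z _ => (Z.w_pos z).le
  have p1 : ∑ c, p c = 1 := by
    rw [← Z.sum_w, Finset.sum_fiberwise]
  have hpush : ∀ P : X.Atom × U.Atom → Prop, ∑ c with P c, p c
      = ∑ z with P (app f z, app g z), Z.w z := by
    intro P
    exact sum_filter_fiberwise (fun z => (app f z, app g z)) P Z.w
  let l := ofWeights p p0 p1
  let a' : l ⟶ X := homOfPush Prod.fst fun y => by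
    rw [hpush (fun c => c.1 = y), ← app_push f]
  let b' : l ⟶ U := homOfPush Prod.snd fun y => by
    rw [hpush (fun c => c.2 = y), ← app_push g]
  have hm : ∀ z, (app f z, app g z) ∈ l.pmf.support := fun z => by
    rw [mem_ofWeights]
    exact lt_of_lt_of_le (Z.w_pos z) (Finset.single_le_sum (f := Z.w)
      (fun a _ => (Z.w_pos a).le) (by simp))
  let k : Z ⟶ l := Hom.mk (Y := l) (fun z => ⟨(app f z, app g z), hm z⟩) fun y => by
    rw [w_ofWeights]
    refine Finset.sum_congr ?_ fun _ _ => rfl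
    ext z
    simp only [Finset.mem_filter, Finset.mem_univ, true_and]
    exact Atom.ext_iff
  have := h l a' b' k rfl rfl
  exact injective_of_isIso k (Atom.ext (Prod.ext hf hg))

/-! ### Entropy inequalities -/

/-- The right-hand side is the tangent line at `t` of the concave function `negMulLog`. -/
theorem negMulLog_le_add {c t : ℝ} (hc : 0 ≤ c) (ht : 0 < t) :
    Real.negMulLog c ≤ -c * Real.log t + (t - c) := by
  rcases hc.eq_or_lt with rfl | hc
  · simpa using ht.le
  · have h := Real.log_le_sub_one_of_pos (div_pos ht hc)
    rw [Real.log_div ht.ne' hc.ne'] at h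
    have h2 := mul_le_mul_of_nonneg_left h hc.le
    have : c * (t / c - 1) = t - c := by field_simp
    rw [Real.negMulLog]
    linarith

/-- Among the functions on a set of at most `M` elements with sum `δ`, the constant one has the
largest entropy. -/
theorem sum_negMulLog_le {ι : Type*} (s : Finset ι) (c : ι → ℝ) (hc : ∀ i ∈ s, 0 ≤ c i) {δ M : ℝ}
    (hδ : ∑ i ∈ s, c i = δ) (hM : 0 < M) (hs : (s.card : ℝ) ≤ M) :
    ∑ i ∈ s, Real.negMulLog (c i) ≤ δ * Real.log M + Real.negMulLog δ := by
  have hδ0 : 0 ≤ δ := hδ ▸ Finset.sum_nonneg hc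
  rcases hδ0.eq_or_lt with rfl | hpos
  · rw [Finset.sum_eq_zero_iff_of_nonneg hc] at hδ
    rw [Finset.sum_eq_zero fun i hi => by simp [hδ i hi]]
    simp
  · calc ∑ i ∈ s, Real.negMulLog (c i)
        ≤ ∑ i ∈ s, (-c i * Real.log (δ / M) + (δ / M - c i)) :=
          Finset.sum_le_sum fun i hi => negMulLog_le_add (hc i hi) (div_pos hpos hM)
      _ = -δ * Real.log (δ / M) + (s.card * (δ / M) - δ) := by
          rw [Finset.sum_add_distrib, ← Finset.sum_mul, Finset.sum_neg_distrib, hδ,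
            Finset.sum_sub_distrib, hδ, Finset.sum_const, nsmul_eq_mul]
      _ ≤ -δ * Real.log (δ / M) + (M * (δ / M) - δ) := by gcongr
      _ = δ * Real.log M + Real.negMulLog δ := by
          rw [Real.log_div hpos.ne' hM.ne', Real.negMulLog]
          field_simp
          ring

theorem ent_le_log (X : FinProb.{v}) {M : ℝ} (h : (Fintype.card X.Atom : ℝ) ≤ M) :
    X.ent ≤ Real.log M := by
  have := X.atom_nonempty
  have h1 := sum_negMulLog_le Finset.univ X.w (fun x _ => (X.w_pos x).le) X.sum_w
    (M := M) (lt_of_lt_of_le (by exact_mod_cast Fintype.card_pos) h) (by simpa using h)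
  simpa [ent] using h1

-- Merging atoms loses entropy: each `c i` is at most the sum, and the logarithm is monotone.
open Classical in
theorem negMulLog_sum_le {ι : Type*} (s : Finset ι) (c : ι → ℝ) (hc : ∀ i ∈ s, 0 < c i) :
    Real.negMulLog (∑ i ∈ s, c i) ≤ ∑ i ∈ s, Real.negMulLog (c i) := by
  simp only [Real.negMulLog]
  rw [← Finset.sum_neg_distrib, Finset.sum_mul]
  refine Finset.sum_le_sum fun i hi => ?_
  have := Real.log_le_log (hc i hi) (Finset.single_le_sum (fun j hj => (hc j hj).le) hi)
  have := mul_le_mul_of_nonneg_left this (hc i hi).le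
  linarith

/-- Entropy does not increase under reductions. -/
theorem ent_le_ent {X Y : FinProb.{v}} (f : X ⟶ Y) : Y.ent ≤ X.ent := by
  classical
  rw [ent, ent, ← Finset.sum_fiberwise (g := app f)]
  refine Finset.sum_le_sum fun y _ => ?_
  rw [← app_push f]
  exact negMulLog_sum_le _ _ fun x _ => X.w_pos x

theorem condEnt_le_log {X Y : FinProb.{v}} (f : X ⟶ Y) {M : ℝ}
    (h : ∀ y, (Nat.card {x // app f x = y} : ℝ) ≤ M) : condEnt f ≤ Real.log M := by
  classical
  calc condEnt f ≤ ∑ y, Y.w y * Real.log M := by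
        refine Finset.sum_le_sum fun y _ => mul_le_mul_of_nonneg_left ?_ (Y.w_pos y).le
        obtain ⟨x, hx⟩ := app_surjective f y
        have hcard : Nat.card {x // app f x = y} = (Finset.univ.filter fun x => app f x = y).card := by
          rw [Nat.card_eq_fintype_card, Fintype.card_subtype]
        have h2 := sum_negMulLog_le (Finset.univ.filter fun x => app f x = y)
          (fun x => X.w x / Y.w y) (fun x _ => (div_pos (X.w_pos x) (Y.w_pos y)).le) (δ := 1)
          (by rw [← Finset.sum_div, app_push, div_self (Y.w_pos y).ne']) (M := M)
          (lt_of_lt_of_le (by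
            rw [hcard]
            exact_mod_cast Finset.card_pos.2 ⟨x, by simpa using hx⟩) (h y)) (hcard ▸ h y)
        simpa using h2
    _ = Real.log M := by rw [← Finset.sum_mul, Y.sum_w, one_mul]

end FinProb

/-! ### Additivity of entropy under tensor products and powers -/

namespace ProbDiag

theorem ent_tensorSpace (A B : FinProb.{v}) : (tensorSpace A B).ent = A.ent + B.ent := by
  rw [tensorSpace, FinProb.ent_ofWeights, Fintype.sum_prod_type]
  simp_rw [Real.negMulLog_mul, Finset.sum_add_distrib, ← Finset.sum_mul, ← Finset.mul_sum, B.sum_w,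
    ← Finset.sum_mul, A.sum_w, one_mul]
  rfl

theorem prod_w_pos (A : FinProb.{v}) {n : ℕ} (a : Fin n → A.Atom) : 0 < ∏ k, A.w (a k) :=
  Finset.prod_pos fun _ _ => A.w_pos _

theorem sum_prod_w (n : ℕ) (A : FinProb.{v}) : ∑ a : Fin n → A.Atom, ∏ k, A.w (a k) = 1 := by
  classical
  have h := Finset.prod_univ_sum (fun _ : Fin n => (Finset.univ : Finset A.Atom))
    (fun _ a => A.w a)
  simp only [A.sum_w, Finset.prod_const_one, Fintype.piFinset_univ] at h
  exact h.symm

theorem ent_powSpace (n : ℕ) (A : FinProb.{v}) : (powSpace n A).ent = n * A.ent := by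
  rw [powSpace, FinProb.ent_ofWeights]
  induction n with
  | zero => simp
  | succ n ih =>
    rw [← (Fin.consEquiv (fun _ : Fin (n + 1) => A.Atom)).sum_comp, Fintype.sum_prod_type]
    simp only [Fin.consEquiv_apply, Fin.prod_univ_succ, Fin.cons_zero, Fin.cons_succ,
      Real.negMulLog_mul, Finset.sum_add_distrib, ← Finset.sum_mul, ← Finset.mul_sum, sum_prod_w, ih,
      A.sum_w]
    rw [FinProb.ent]
    push_cast
    ring

end ProbDiag

/-! ### Existence of the asymptotic entropy distance -/

namespace ProbDiag

section distance
variable {H : Type u} [Preorder H]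

theorem fanDist_nonneg [Finite H] {X Y Z : H ⥤ FinProb.{v}} (f : Z ⟶ X) (g : Z ⟶ Y) :
    0 ≤ fanDist f g :=
  add_nonneg (finsum_nonneg fun _ => abs_nonneg _) (finsum_nonneg fun _ => abs_nonneg _)

theorem bddBelow_fanDist [Finite H] (X Y : H ⥤ FinProb.{v}) :
    BddBelow {r | ∃ (Z : H ⥤ FinProb.{v}) (f : Z ⟶ X) (g : Z ⟶ Y), r = fanDist f g} :=
  ⟨0, by rintro _ ⟨Z, f, g, rfl⟩; exact fanDist_nonneg f g⟩

theorem ikd_le_fanDist [Finite H] {X Y Z : H ⥤ FinProb.{v}} (f : Z ⟶ X) (g : Z ⟶ Y) :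
    ikd X Y ≤ fanDist f g :=
  csInf_le (bddBelow_fanDist X Y) ⟨Z, f, g, rfl⟩

theorem le_ikd [Finite H] {X Y : H ⥤ FinProb.{v}} {r : ℝ}
    (h : ∀ (Z : H ⥤ FinProb.{v}) (f : Z ⟶ X) (g : Z ⟶ Y), r ≤ fanDist f g) : r ≤ ikd X Y :=
  le_csInf (exists_fan X Y) (by rintro _ ⟨Z, f, g, rfl⟩; exact h Z f g)

theorem ikd_nonneg [Finite H] (X Y : H ⥤ FinProb.{v}) : 0 ≤ ikd X Y :=
  le_ikd fun _ f g => fanDist_nonneg f g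

theorem ikd_self [Finite H] (X : H ⥤ FinProb.{v}) : ikd X X = 0 :=
  le_antisymm ((ikd_le_fanDist (𝟙 X) (𝟙 X)).trans (by simp [fanDist])) (ikd_nonneg X X)

/-- The tensor product of two morphisms of diagrams. -/
noncomputable def tensorMap {X X' Y Y' : H ⥤ FinProb.{v}} (f : X ⟶ X') (g : Y ⟶ Y') :
    tensor X Y ⟶ tensor X' Y' where
  app i := FinProb.homOfWeights (h0 := tensor_nonneg _ _) (h1 := tensor_sum _ _)
    (k0 := tensor_nonneg _ _) (k1 := tensor_sum _ _)
    (Prod.map (FinProb.app (f.app i)) (FinProb.app (g.app i)))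
    (fun b => by rw [← prod_push]; congr!)
  naturality i j h := by
    apply FinProb.hom_ext
    intro x
    apply FinProb.Atom.ext
    let a : (X.obj i).Atom × (Y.obj i).Atom := x.val
    exact Prod.ext (congrArg (fun k => FinProb.app k a.1) (f.naturality h))
      (congrArg (fun k => FinProb.app k a.2) (g.naturality h))

/-- The tensor power of a morphism of diagrams. -/
noncomputable def powMap {X Y : H ⥤ FinProb.{v}} (f : X ⟶ Y) (n : ℕ) : pow X n ⟶ pow Y n where
  app i := FinProb.homOfWeights (h0 := fun a => (prod_w_pos _ a).le) (h1 := sum_prod_w _ _)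
    (k0 := fun a => (prod_w_pos _ a).le) (k1 := sum_prod_w _ _)
    (fun a k => FinProb.app (f.app i) (a k)) (fun b => by rw [← pow_push]; congr!)
  naturality i j h := by
    apply FinProb.hom_ext
    intro x
    apply FinProb.Atom.ext
    let a : Fin n → (X.obj i).Atom := x.val
    exact funext fun k => congrArg (fun l => FinProb.app l (a k)) (f.naturality h)

open Classical in
theorem append_push (A : FinProb.{v}) (m n : ℕ) (c : Fin (m + n) → A.Atom) :
    ∑ a : (powSpace m A).Atom × (powSpace n A).Atom with
      Fin.append (FinProb.pt a.1) (FinProb.pt a.2) = c,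
      (powSpace m A).w a.1 * (powSpace n A).w a.2 = ∏ k, A.w (c k) := by
  obtain ⟨a, ha⟩ : ∃ a : (powSpace m A).Atom, FinProb.pt a = fun k => c (Fin.castAdd n k) :=
    FinProb.exists_pt_eq (prod_w_pos A _)
  obtain ⟨b, hb⟩ : ∃ b : (powSpace n A).Atom, FinProb.pt b = fun k => c (Fin.natAdd m k) :=
    FinProb.exists_pt_eq (prod_w_pos A _)
  rw [Finset.sum_eq_single_of_mem (a, b)]
  · have e : ∀ (n : ℕ) (a : (powSpace n A).Atom), (powSpace n A).w a = ∏ k, A.w (FinProb.pt a k) :=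
      fun n a => FinProb.w_ofWeights _ _ _ a
    rw [e, e, Fin.prod_univ_add]
    rw [ha, hb]
  · simp [ha, hb, Fin.append_castAdd_natAdd]
  · rintro ⟨a', b'⟩ h hne
    refine absurd ?_ hne
    have h : Fin.append (FinProb.pt a') (FinProb.pt b') = c := (Finset.mem_filter.1 h).2
    refine Prod.ext (FinProb.pt_ext ?_) (FinProb.pt_ext ?_)
    · change FinProb.pt a' = FinProb.pt a
      rw [ha, ← h]
      ext1 k
      rw [Fin.append_left]
    · change FinProb.pt b' = FinProb.pt b
      rw [hb, ← h]
      ext1 k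
      rw [Fin.append_right]

/-- Concatenation of samples. -/
noncomputable def appendHom (A : FinProb.{v}) (m n : ℕ) :
    tensorSpace (powSpace m A) (powSpace n A) ⟶ powSpace (m + n) A :=
  FinProb.homOfWeights (h0 := tensor_nonneg _ _) (h1 := tensor_sum _ _)
    (k0 := fun a => (prod_w_pos _ a).le) (k1 := sum_prod_w _ _)
    (fun a : (powSpace m A).Atom × (powSpace n A).Atom =>
      Fin.append (FinProb.pt a.1) (FinProb.pt a.2))
    (fun b => by rw [← append_push]; congr!)

/-- The tensor product of two powers of a diagram maps to a power of it. -/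
noncomputable def tensorPow (X : H ⥤ FinProb.{v}) (m n : ℕ) :
    tensor (pow X m) (pow X n) ⟶ pow X (m + n) where
  app i := appendHom (X.obj i) m n
  naturality i j h := by
    apply FinProb.hom_ext
    intro x
    apply FinProb.Atom.ext
    refine funext fun k => ?_
    refine Fin.addCases (fun k => ?_) (fun k => ?_) k
    · exact (Fin.append_left _ _ _).trans
        (congrArg (FinProb.app (X.map h)) (Fin.append_left _ _ _).symm)
    · exact (Fin.append_right _ _ _).trans
        (congrArg (FinProb.app (X.map h)) (Fin.append_right _ _ _).symm)

/-- The tensor product of a fan for the `m`-th powers and one for the `n`-th powers, followed by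
concatenation, is a fan for the `(m + n)`-th powers. Entropies add, so the distances add at most. -/
theorem subadditive_ikd_pow [Finite H] (X Y : H ⥤ FinProb.{v}) :
    Subadditive fun n => ikd (pow X n) (pow Y n) := by
  intro m n
  rw [← sub_le_iff_le_add]
  -- Moving one infimum at a time to the smaller side allows arbitrary fans, so no near-optimal ones
  -- have to be chosen.
  refine le_ikd fun Z f g => ?_
  rw [sub_le_comm]
  refine le_ikd fun W k l => ?_
  rw [sub_le_iff_le_add]
  refine (ikd_le_fanDist (tensorMap f k ≫ tensorPow X m n)
    (tensorMap g l ≫ tensorPow Y m n)).trans ?_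
  have := Fintype.ofFinite H
  have e : ∀ (V : H ⥤ FinProb.{v}) (i : H) (n : ℕ), ((pow V n).obj i).ent = n * (V.obj i).ent :=
    fun V i n => ent_powSpace n (V.obj i)
  have e' : ∀ i, ((tensor Z W).obj i).ent = (Z.obj i).ent + (W.obj i).ent :=
    fun i => ent_tensorSpace _ _
  have key : ∀ V : H ⥤ FinProb.{v}, ∑ i, |((tensor Z W).obj i).ent - ((pow V (m + n)).obj i).ent|
      ≤ ∑ i, |(Z.obj i).ent - ((pow V m).obj i).ent|
        + ∑ i, |(W.obj i).ent - ((pow V n).obj i).ent| := by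
    intro V
    rw [← Finset.sum_add_distrib]
    refine Finset.sum_le_sum fun i _ => ?_
    rw [e', e, e, e]
    refine le_trans (le_of_eq ?_) (abs_add_le _ _)
    congr 1
    push_cast
    ring
  have hX := key X
  have hY := key Y
  simp only [fanDist, finsum_eq_sum_of_fintype]
  linarith

theorem ikd_pow_one_le [Finite H] (X Y : H ⥤ FinProb.{v}) :
    ikd (pow X 1) (pow Y 1) ≤ ikd X Y := by
  refine le_ikd fun Z f g => (ikd_le_fanDist (powMap f 1) (powMap g 1)).trans (le_of_eq ?_)
  have e : ∀ (V : H ⥤ FinProb.{v}) (i : H), ((pow V 1).obj i).ent = (V.obj i).ent :=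
    fun V i => (ent_powSpace 1 (V.obj i)).trans (by simp)
  simp only [fanDist, e]

/-- The asymptotic entropy distance exists and is bounded by the intrinsic one. -/
theorem exists_isAikd [Finite H] (X Y : H ⥤ FinProb.{v}) : ∃ d, IsAikd X Y d ∧ d ≤ ikd X Y := by
  have hs := subadditive_ikd_pow X Y
  have hb : BddBelow (Set.range fun n : ℕ => ikd (pow X n) (pow Y n) / n) :=
    ⟨0, by rintro _ ⟨n, rfl⟩; exact div_nonneg (ikd_nonneg _ _) n.cast_nonneg⟩
  refine ⟨hs.lim, hs.tendsto_lim hb, (hs.lim_le_div hb one_ne_zero).trans ?_⟩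
  simpa using ikd_pow_one_le X Y

end distance

/-! ### Coupling a diagram with one that it dominates up to a factor -/

section coupling
variable {H : Type u} [Preorder H] {X Y : H ⥤ FinProb.{v}}

open Classical in
/-- The part of the weights of `X` which is not covered by `t` times the image of `Y`. -/
noncomputable def excess (e : ∀ i, (Y.obj i).Atom → (X.obj i).Atom) (t : ℝ) (i : H)
    (a : (X.obj i).Atom) : ℝ :=
  (X.obj i).w a - t * ∑ y with e i y = a, (Y.obj i).w y

/-- The weights of the space which selects either all of `Y`, or an atom of `X` according to the
excess. -/
noncomputable def selWeight (e : ∀ i, (Y.obj i).Atom → (X.obj i).Atom) (t : ℝ) (i : H) :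
    Option (X.obj i).Atom → ℝ
  | none => t
  | some a => excess e t i a

variable (e : ∀ i, (Y.obj i).Atom → (X.obj i).Atom) (t : ℝ)

theorem sum_excess (i : H) : ∑ a, excess e t i a = 1 - t := by
  classical
  simp only [excess, Finset.sum_sub_distrib, FinProb.sum_w, ← Finset.mul_sum]
  have := Finset.sum_fiberwise Finset.univ (e i) (Y.obj i).w
  rw [FinProb.sum_w] at this
  rw [this, mul_one]

theorem sum_selWeight (i : H) : ∑ a, selWeight e t i a = 1 := by
  rw [Fintype.sum_option]
  simp [selWeight, sum_excess]

variable {e t}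

theorem selWeight_nonneg (ht : 0 ≤ t) (hc : ∀ i a, 0 ≤ excess e t i a) (i : H)
    (a : Option (X.obj i).Atom) : 0 ≤ selWeight e t i a := by
  cases a
  exacts [ht, hc i _]

open Classical in
theorem excess_push (he : ∀ {i j : H} (h : i ⟶ j) (y : (Y.obj i).Atom),
      e j (FinProb.app (Y.map h) y) = FinProb.app (X.map h) (e i y)) {i j : H} (h : i ⟶ j)
    (b : (X.obj j).Atom) :
    ∑ a with FinProb.app (X.map h) a = b, excess e t i a = excess e t j b := by
  simp only [excess, Finset.sum_sub_distrib, FinProb.app_push, ← Finset.mul_sum]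
  congr 2
  rw [FinProb.sum_filter_fiberwise (e i) (fun a => FinProb.app (X.map h) a = b)]
  simp_rw [← he, ← FinProb.app_push (Y.map h)]
  rw [FinProb.sum_filter_fiberwise (FinProb.app (Y.map h)) (fun y => e j y = b)]

end coupling
end ProbDiag

namespace ProbDiag

section coupling
variable {H : Type u} [Preorder H] {X Y : H ⥤ FinProb.{v}}
  {e : ∀ i, (Y.obj i).Atom → (X.obj i).Atom} {t : ℝ}

/-- The diagram of selector spaces: with probability `t` nothing is selected, and otherwise an atom
of `X`, distributed according to the excess. -/
noncomputable def selector (he : ∀ {i j : H} (h : i ⟶ j) (y : (Y.obj i).Atom),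
      e j (FinProb.app (Y.map h) y) = FinProb.app (X.map h) (e i y)) (ht : 0 ≤ t)
    (hc : ∀ i a, 0 ≤ excess e t i a) : H ⥤ FinProb.{v} where
  obj i := FinProb.ofWeights (selWeight e t i) (selWeight_nonneg ht hc i) (sum_selWeight e t i)
  map {i j} h := FinProb.homOfWeights (Option.map (FinProb.app (X.map h))) (fun b => by
    classical
    rw [Finset.sum_filter, Fintype.sum_option]
    cases b with
    | none => simp [selWeight]
    | some b =>
      change _ = excess e t j b
      rw [← excess_push he h, Finset.sum_filter]
      simp [selWeight])
  map_id i := FinProb.hom_ext fun x => FinProb.pt_ext <|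
    (congrArg (fun f => Option.map f (FinProb.pt x)) (funext fun a => app_map_id X i a)).trans
      (congrFun Option.map_id _)
  map_comp f g := FinProb.hom_ext fun x => FinProb.pt_ext <|
    (congrArg (fun f => Option.map f (FinProb.pt x)) (funext fun a => app_map_comp X f g a)).trans
      (Option.map_map _ _ _).symm

open Classical in
/-- The projection to `X` of the product of the selector with `Y`. -/
noncomputable def selectorFst (he : ∀ {i j : H} (h : i ⟶ j) (y : (Y.obj i).Atom),
      e j (FinProb.app (Y.map h) y) = FinProb.app (X.map h) (e i y)) (ht : 0 ≤ t)
    (hc : ∀ i a, 0 ≤ excess e t i a) : tensor (selector he ht hc) Y ⟶ X where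
  app i := FinProb.homOfPush (h0 := tensor_nonneg _ _) (h1 := tensor_sum _ _)
    -- If nothing is selected, the value defaults to the image of the atom of `Y`. An atom then gets
    -- its excess plus `t` times its mass under the image of `Y`, which is its weight in `X`.
    (fun a : ((selector he ht hc).obj i).Atom × (Y.obj i).Atom =>
      (show Option (X.obj i).Atom from a.1.val).getD (e i a.2)) (fun x => by
    have h := FinProb.sum_atom (selWeight e t i) (selWeight_nonneg ht hc i) (sum_selWeight e t i)
      (fun o => selWeight e t i o * ∑ y, if o.getD (e i y) = x then (Y.obj i).w y else 0)
      (fun o ho => by rw [ho, zero_mul])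
    rw [Fintype.sum_option] at h
    rw [Finset.sum_filter, Fintype.sum_prod_type]
    refine Eq.trans (Finset.sum_congr rfl fun o _ => ?_) (h.trans ?_)
    · rw [Finset.mul_sum]
      refine Finset.sum_congr rfl fun y _ => ?_
      rw [mul_ite, mul_zero]
      have : ((selector he ht hc).obj i).w o = selWeight e t i o.val :=
        FinProb.w_ofWeights (selWeight e t i) (selWeight_nonneg ht hc i) (sum_selWeight e t i) o
      rw [this]
      rfl
    · have h2 : ∀ a, (∑ y, if a = x then (Y.obj i).w y else 0) = if a = x then 1 else 0 := by
        intro a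
        split_ifs
        · exact FinProb.sum_w _
        · simp
      simp only [Option.getD_none, Option.getD_some, selWeight, h2]
      simp [excess, Finset.sum_filter])
  naturality i j h := by
    apply FinProb.hom_ext
    intro x
    let a : ((selector he ht hc).obj i).Atom × (Y.obj i).Atom := x.val
    let o : Option (X.obj i).Atom := a.1.val
    change (Option.map (FinProb.app (X.map h)) o).getD (e j (FinProb.app (Y.map h) a.2))
      = FinProb.app (X.map h) (o.getD (e i a.2))
    rw [he]
    cases o <;> rfl

/-- Applied to `t` and to `1 - t`, this bounds the binary entropy of the selector's first choice by
`1`. -/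
theorem negMulLog_le_one_sub {s : ℝ} (hs : 0 ≤ s) : Real.negMulLog s ≤ 1 - s := by
  simpa using FinProb.negMulLog_le_add hs one_pos

theorem ent_selector_le (he : ∀ {i j : H} (h : i ⟶ j) (y : (Y.obj i).Atom),
      e j (FinProb.app (Y.map h) y) = FinProb.app (X.map h) (e i y)) (ht : 0 ≤ t) (ht1 : t ≤ 1)
    (hc : ∀ i a, 0 ≤ excess e t i a) (i : H) {M : ℝ} (hM : (Fintype.card (X.obj i).Atom : ℝ) ≤ M) :
    ((selector he ht hc).obj i).ent ≤ 1 + (1 - t) * Real.log M := by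
  have h : ((selector he ht hc).obj i).ent = ∑ o, Real.negMulLog (selWeight e t i o) :=
    FinProb.ent_ofWeights _ (selWeight_nonneg ht hc i) (sum_selWeight e t i)
  have := (X.obj i).atom_nonempty
  rw [h, Fintype.sum_option]
  have h1 := FinProb.sum_negMulLog_le Finset.univ (excess e t i) (fun a _ => hc i a)
    (sum_excess e t i) (M := M) (lt_of_lt_of_le (by exact_mod_cast Fintype.card_pos) hM)
    (by simpa using hM)
  have h2 := negMulLog_le_one_sub ht
  have h3 := negMulLog_le_one_sub (sub_nonneg.2 ht1)
  simp only [selWeight]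
  linarith

/-- `X` is the mixture of the image of `Y` with weight `t` and of the normalised excess with weight
`1 - t`. By concavity its entropy is at least the mean of theirs. The selector's entropy is the
binary entropy of `t` plus `1 - t` times that of the normalised excess, so only the binary entropy
and `(1 - t)` times the entropy of `Y` remain. -/
theorem ent_selector_tensor_le (he : ∀ {i j : H} (h : i ⟶ j) (y : (Y.obj i).Atom),
      e j (FinProb.app (Y.map h) y) = FinProb.app (X.map h) (e i y)) (ht : 0 < t) (ht1 : t < 1)
    (hc : ∀ i a, 0 ≤ excess e t i a) (i : H) (hinj : Function.Injective (e i)) {M : ℝ}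
    (hM : (Fintype.card (X.obj i).Atom : ℝ) ≤ M) :
    ((selector he ht.le hc).obj i).ent + (Y.obj i).ent
      ≤ (X.obj i).ent + (1 + (1 - t) * Real.log M) := by
  classical
  have h : ((selector he ht.le hc).obj i).ent = ∑ o, Real.negMulLog (selWeight e t i o) :=
    FinProb.ent_ofWeights _ (selWeight_nonneg ht.le hc i) (sum_selWeight e t i)
  rw [h, Fintype.sum_option]
  simp only [selWeight]
  have hY : (Y.obj i).ent ≤ Real.log M := FinProb.ent_le_log _ (le_trans (by
    exact_mod_cast Fintype.card_le_of_injective _ hinj) hM)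
  set q : (X.obj i).Atom → ℝ := fun a => ∑ y with e i y = a, (Y.obj i).w y with hq
  have hq0 : ∀ a, 0 ≤ q a := fun a => Finset.sum_nonneg fun y _ => ((Y.obj i).w_pos y).le
  have hqe : ∑ a, Real.negMulLog (q a) = (Y.obj i).ent := by
    rw [FinProb.ent]
    symm
    refine Finset.sum_of_injOn (e i) hinj.injOn (fun _ _ => by simp) ?_ ?_
    · intro a _ ha
      have : q a = 0 := by
        refine Finset.sum_eq_zero fun y hy => absurd ?_ ha
        exact ⟨y, by simp, (Finset.mem_filter.1 hy).2⟩
      rw [this, Real.negMulLog_zero]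
    · intro y _
      congr 1
      simp only [hq, hinj.eq_iff]
      simp [Finset.sum_filter]
  have hs : 0 < 1 - t := sub_pos.2 ht1
  have hconc : ∀ a, t * Real.negMulLog (q a) + (Real.negMulLog (excess e t i a)
      + excess e t i a * Real.log (1 - t)) ≤ Real.negMulLog ((X.obj i).w a) := by
    intro a
    have h1 := Real.concaveOn_negMulLog.2 (Set.mem_Ici.2 (hq0 a))
      (Set.mem_Ici.2 (div_nonneg (hc i a) hs.le)) ht.le hs.le (by ring)
    simp only [smul_eq_mul] at h1
    have h2 : t * q a + (1 - t) * (excess e t i a / (1 - t)) = (X.obj i).w a := by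
      rw [mul_div_cancel₀ _ hs.ne', excess, hq]
      ring
    have h3 : (1 - t) * Real.negMulLog (excess e t i a / (1 - t))
        = Real.negMulLog (excess e t i a) + excess e t i a * Real.log (1 - t) := by
      rcases (hc i a).eq_or_lt with h0 | h0
      · simp [← h0]
      · rw [Real.negMulLog, Real.negMulLog, Real.log_div h0.ne' hs.ne']
        field_simp
        ring
    rw [h2, h3] at h1
    exact h1
  have hsum := Finset.sum_le_sum fun a (_ : a ∈ Finset.univ) => hconc a
  rw [Finset.sum_add_distrib, Finset.sum_add_distrib, ← Finset.mul_sum, ← Finset.sum_mul,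
    sum_excess, hqe] at hsum
  have h2 := negMulLog_le_one_sub ht.le
  have h3 := negMulLog_le_one_sub hs.le
  have h4 : (1 - t) * Real.log (1 - t) = - Real.negMulLog (1 - t) := by rw [Real.negMulLog]; ring
  have h5 := mul_le_mul_of_nonneg_left hY hs.le
  change _ ≤ (X.obj i).ent at hsum
  linarith

/-- If each space of `X` dominates `t` times the image of the corresponding space of `Y`, then the
intrinsic entropy distance of `X` and `Y` is small. -/
theorem ikd_le_of_excess_nonneg [Fintype H] (he : ∀ {i j : H} (h : i ⟶ j) (y : (Y.obj i).Atom),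
      e j (FinProb.app (Y.map h) y) = FinProb.app (X.map h) (e i y)) (ht : 0 < t) (ht1 : t < 1)
    (hc : ∀ i a, 0 ≤ excess e t i a) (hinj : ∀ i, Function.Injective (e i)) {M : ℝ}
    (hM : ∀ i, (Fintype.card (X.obj i).Atom : ℝ) ≤ M) :
    ikd X Y ≤ Fintype.card H * (2 * (1 + (1 - t) * Real.log M)) := by
  refine (ikd_le_fanDist (selectorFst he ht.le hc) (tensorSnd _ _)).trans ?_
  rw [fanDist, finsum_eq_sum_of_fintype, finsum_eq_sum_of_fintype, ← Finset.sum_add_distrib,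
    ← nsmul_eq_mul]
  refine Finset.sum_le_card_nsmul _ _ _ fun i _ => ?_
  -- Both legs of the fan are reductions, so both absolute values open with the same sign.
  have h1 := FinProb.ent_le_ent ((selectorFst he ht.le hc).app i)
  have h2 := FinProb.ent_le_ent ((tensorSnd (selector he ht.le hc) Y).app i)
  have h3 : ((tensor (selector he ht.le hc) Y).obj i).ent = _ := ent_tensorSpace _ _
  have h4 := ent_selector_le he ht.le ht1.le hc i (hM i)
  have h5 := ent_selector_tensor_le he ht ht1 hc i (hinj i) (hM i)
  rw [abs_of_nonneg (sub_nonneg.2 h1), abs_of_nonneg (sub_nonneg.2 h2), h3]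
  linarith

end coupling
end ProbDiag

/-! ### Random sampling -/

open Classical in
/-- The exponential moment of the number of hits among `N` uniform samples. -/
theorem sum_exp_card_filter {U : Type*} [Fintype U] (P : U → Prop) (N : ℕ) (s : ℝ) :
    ∑ w : Fin N → U, Real.exp (s * (Finset.univ.filter fun n => P (w n)).card)
      = ((Fintype.card U : ℝ) + (Finset.univ.filter P).card * (Real.exp s - 1)) ^ N := by
  have h1 : ∀ w : Fin N → U, Real.exp (s * (Finset.univ.filter fun n => P (w n)).card)
      = ∏ n, (1 + if P (w n) then Real.exp s - 1 else 0) := by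
    intro w
    have : ∀ n, (1 + if P (w n) then Real.exp s - 1 else 0) = Real.exp (if P (w n) then s else 0) := by
      intro n
      split_ifs <;> simp
    simp_rw [this]
    rw [← Real.exp_sum, ← Finset.sum_filter, Finset.sum_const, nsmul_eq_mul, mul_comm]
  simp_rw [h1]
  have h2 := Finset.prod_univ_sum (fun _ : Fin N => (Finset.univ : Finset U))
    (fun _ a => 1 + if P a then Real.exp s - 1 else 0)
  rw [Fintype.piFinset_univ] at h2
  rw [← h2, Finset.prod_const, Finset.card_univ, Fintype.card_fin, Finset.sum_add_distrib,
    ← Finset.sum_filter]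
  simp [mul_sub]

open Classical in
/-- A Chernoff bound together with a union bound: if each `y` is hit by a proportion `q` of the
elements of `U`, then some sequence of length `N` hits no `y` much more often than expected. -/
theorem exists_sample_le {U Y : Type*} [Fintype U] [Nonempty U] [Fintype Y] [Nonempty Y]
    (R : U → Y → Prop) {q ε : ℝ}
    (hR : ∀ y, ((Finset.univ.filter fun a => R a y).card : ℝ) = q * Fintype.card U)
    (hε : 0 < ε) (hε1 : ε ≤ 1) {N : ℕ}
    (hN : Real.log (Fintype.card Y) < N * q * (ε ^ 2 / 4)) :
    ∃ w : Fin N → U, ∀ y,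
      ((Finset.univ.filter fun n => R (w n) y).card : ℝ) ≤ (1 + ε) * (N * q) := by
  by_contra! hcon
  have hU : (0 : ℝ) < Fintype.card U := by exact_mod_cast Fintype.card_pos
  have hY : (0 : ℝ) < Fintype.card Y := by exact_mod_cast Fintype.card_pos
  have hq : 0 ≤ q := by
    obtain ⟨y⟩ := ‹Nonempty Y›
    by_contra h
    have h1 := mul_neg_of_neg_of_pos (not_le.1 h) hU
    rw [← hR y] at h1
    exact absurd h1 (not_lt.2 (Nat.cast_nonneg _))
  -- The tilt `s = ε / 2` maximises `s * ε - s ^ 2`, the gain per expected hit. If every sequence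
  -- overhits some `y`, each contributes at least the exponential of its threshold.
  have hlow : (Fintype.card U : ℝ) ^ N * Real.exp (ε / 2 * ((1 + ε) * (N * q)))
      ≤ ∑ w : Fin N → U, ∑ y,
        Real.exp (ε / 2 * (Finset.univ.filter fun n => R (w n) y).card) := by
    have h1 : ((Fintype.card U : ℝ) ^ N) = ((Finset.univ : Finset (Fin N → U)).card : ℝ) := by
      simp
    rw [h1, ← nsmul_eq_mul]
    refine Finset.card_nsmul_le_sum _ _ _ fun w _ => ?_
    obtain ⟨y, hy⟩ := hcon w
    refine le_trans ?_ (Finset.single_le_sum (fun y _ => (Real.exp_pos _).le) (Finset.mem_univ y))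
    exact Real.exp_le_exp.2 (mul_le_mul_of_nonneg_left hy.le (by linarith))
  have hexp : Real.exp (ε / 2) - 1 ≤ ε / 2 + (ε / 2) ^ 2 := by
    have := Real.abs_exp_sub_one_sub_id_le (x := ε / 2) (by rw [abs_of_pos] <;> linarith)
    have := (abs_le.1 this).2
    linarith
  have hup : ∑ w : Fin N → U, ∑ y,
        Real.exp (ε / 2 * (Finset.univ.filter fun n => R (w n) y).card)
      ≤ Fintype.card Y * ((Fintype.card U : ℝ) ^ N
        * Real.exp (N * q * (ε / 2 + (ε / 2) ^ 2))) := by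
    rw [Finset.sum_comm]
    have h2 : ∀ y, ∑ w : Fin N → U,
        Real.exp (ε / 2 * (Finset.univ.filter fun n => R (w n) y).card)
        ≤ (Fintype.card U : ℝ) ^ N * Real.exp (N * q * (ε / 2 + (ε / 2) ^ 2)) := by
      intro y
      rw [sum_exp_card_filter (fun a => R a y), hR]
      have h3 : (Fintype.card U : ℝ) + q * Fintype.card U * (Real.exp (ε / 2) - 1)
          ≤ Fintype.card U * Real.exp (q * (ε / 2 + (ε / 2) ^ 2)) := by
        have h4 := Real.add_one_le_exp (q * (ε / 2 + (ε / 2) ^ 2))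
        have h5 := mul_le_mul_of_nonneg_left hexp hq
        have h6 : 1 + q * (Real.exp (ε / 2) - 1) ≤ Real.exp (q * (ε / 2 + (ε / 2) ^ 2)) := by
          linarith
        have := mul_le_mul_of_nonneg_left h6 hU.le
        linarith
      have h7 : 0 ≤ (Fintype.card U : ℝ) + q * Fintype.card U * (Real.exp (ε / 2) - 1) := by
        have : 0 ≤ Real.exp (ε / 2) - 1 := by
          have := Real.add_one_le_exp (ε / 2)
          linarith
        positivity
      refine (pow_le_pow_left₀ h7 h3 N).trans (le_of_eq ?_)
      rw [mul_pow, ← Real.exp_nat_mul]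
      ring_nf
    refine (Finset.sum_le_card_nsmul _ _ _ fun y _ => h2 y).trans (le_of_eq ?_)
    rw [nsmul_eq_mul, Finset.card_univ]
  have h8 := hlow.trans hup
  rw [mul_left_comm (Fintype.card Y : ℝ), ← Real.exp_log hY] at h8
  have h9 := le_of_mul_le_mul_left h8 (pow_pos hU N)
  rw [← Real.exp_add, Real.exp_le_exp] at h9
  -- Since `ε / 2 * (1 + ε) - (ε / 2 + (ε / 2) ^ 2) = ε ^ 2 / 4`, the exponents force `N * q * (ε ^
  -- 2 / 4) ≤ log |Y|`, against `hN`.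
  nlinarith [h9, hN]

open Classical in
/-- The sampling parameters: a sequence of length `N` in `U`, and a factor `t` close to one for
which `t` times the empirical hitting frequency does not exceed its expectation. -/
theorem exists_sample {U Y : Type*} [Fintype U] [Nonempty U] [Fintype Y] (R : U → Y → Prop) {q : ℝ}
    (hq0 : 0 < q) (hq1 : q ≤ 1) (hqY : 1 / Fintype.card Y ≤ q)
    (hR : ∀ y, ((Finset.univ.filter fun a => R a y).card : ℝ) = q * Fintype.card U)
    (hY : 3 ≤ Fintype.card Y) :
    ∃ (N : ℕ) (w : Fin N → U) (t : ℝ), 0 < N ∧ 0 < t ∧ t < 1 ∧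
      (1 - t) * Real.log (Fintype.card Y) ≤ 9 ∧
      (∀ y, ((Finset.univ.filter fun n => R (w n) y).card : ℝ) ≤ Real.log (Fintype.card Y) ^ 4) ∧
      ∀ y, t * (Finset.univ.filter fun n => R (w n) y).card ≤ N * q := by
  have hYR : (3 : ℝ) ≤ Fintype.card Y := by exact_mod_cast hY
  have : Nonempty Y := Fintype.card_pos_iff.1 (by omega)
  set L := Real.log (Fintype.card Y) with hL
  have hL1 : 1 ≤ L := by
    rw [hL, Real.le_log_iff_exp_le (by linarith)]
    exact (Real.exp_one_lt_d9.le.trans (by norm_num)).trans hYR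
  -- The choice `ε = 9 / L` needs `L ≥ 9`. For smaller `L` the bound `(1 - t) * L ≤ 9` is free, so
  -- one sample and `t = 1 / |Y| ≤ q` suffice.
  rcases lt_or_ge L 9 with h9 | h9
  · obtain ⟨a⟩ := ‹Nonempty U›
    have hc : ∀ y, ((Finset.univ.filter fun _ : Fin 1 => R a y).card : ℝ) ≤ 1 := fun y => by
      exact_mod_cast (Finset.card_le_univ _).trans (by simp)
    refine ⟨1, fun _ => a, 1 / Fintype.card Y, one_pos, by positivity, ?_, ?_, fun y => ?_,
      fun y => ?_⟩
    · rw [div_lt_one] <;> linarith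
    · have : 0 ≤ 1 / (Fintype.card Y : ℝ) * L := by positivity
      linarith
    · exact (hc y).trans (one_le_pow₀ hL1)
    · refine (mul_le_mul_of_nonneg_left (hc y) (by positivity)).trans ?_
      simpa using hqY
  · have hL0 : 0 < L := by linarith
    -- With `ε = 9 / L` this gives `N * q * (ε ^ 2 / 4) ≥ 81 / 80 * L`, just above the `L` required
    -- by the union bound.
    set N := ⌈L ^ 3 / (20 * q)⌉₊ with hN
    have hNpos : 0 < N := Nat.ceil_pos.2 (by positivity)
    have hlow : L ^ 3 / 20 ≤ N * q := by
      have := Nat.le_ceil (L ^ 3 / (20 * q))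
      rw [div_le_iff₀ (by positivity)] at this
      rw [← hN] at this
      linarith
    have hup : N * q ≤ L ^ 3 / 20 + 1 := by
      have := (Nat.ceil_lt_add_one (a := L ^ 3 / (20 * q)) (by positivity)).le
      rw [← hN] at this
      have := mul_le_mul_of_nonneg_right this hq0.le
      have h2 : (L ^ 3 / (20 * q) + 1) * q = L ^ 3 / 20 + q := by field_simp
      linarith
    have hε1 : 9 / L ≤ 1 := by rwa [div_le_one hL0]
    obtain ⟨w, hw⟩ := exists_sample_le R hR (ε := 9 / L) (by positivity) hε1 (N := N) (by
      have h3 := mul_le_mul_of_nonneg_right hlow (by positivity : 0 ≤ (9 / L) ^ 2 / 4)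
      refine lt_of_lt_of_le ?_ h3
      have : L ^ 3 / 20 * ((9 / L) ^ 2 / 4) = 81 / 80 * L := by field_simp; norm_num
      rw [this]
      linarith)
    have hpos : 0 < 1 + 9 / L := by positivity
    refine ⟨N, w, 1 / (1 + 9 / L), hNpos, by positivity, ?_, ?_, fun y => ?_, fun y => ?_⟩
    · rw [div_lt_one hpos]
      have : 0 < 9 / L := by positivity
      linarith
    · have : (1 - 1 / (1 + 9 / L)) * L = 9 / (1 + 9 / L) := by field_simp; ring
      rw [this, div_le_iff₀ hpos]
      have : 0 < 9 / L := by positivity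
      linarith
    · refine (hw y).trans ?_
      have h1 : (1 + 9 / L) * (N * q) ≤ 2 * (L ^ 3 / 20 + 1) :=
        mul_le_mul (by linarith) hup (by positivity) (by norm_num)
      have h2 : 9 * L ^ 3 ≤ L ^ 4 := by
        rw [pow_succ L 3, mul_comm]
        exact mul_le_mul_of_nonneg_left h9 (by positivity)
      have h3 : 1 ≤ L ^ 3 := one_le_pow₀ hL1
      linarith
    · rw [div_mul_eq_mul_div, one_mul, div_le_iff₀ hpos, mul_comm]
      linarith [hw y]

/-! ### Homogeneity: uniform weights and isomorphic conditioned diagrams -/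

namespace ProbDiag

theorem isIso_of_injective {H : Type u} [Preorder H] {X Y : H ⥤ FinProb.{v}} (f : X ⟶ Y)
    (h : ∀ i, Function.Injective (FinProb.app (f.app i))) : IsIso f :=
  have : ∀ i, IsIso (f.app i) := fun i => FinProb.isIso_of_injective _ (h i)
  NatIso.isIso_of_isIso_app f

section homogeneous
variable {H : Type u} [Preorder H] {Z : H ⥤ FinProb.{v}}

theorem aut_app_injective (φ : Aut Z) (i : H) :
    Function.Injective (FinProb.app (φ.hom.app i)) :=
  have : IsIso φ.hom := (show Z ≅ Z from φ).isIso_hom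
  FinProb.injective_of_isIso _

theorem w_app_aut (φ : Aut Z) (i : H) (a : (Z.obj i).Atom) :
    (Z.obj i).w (FinProb.app (φ.hom.app i) a) = (Z.obj i).w a :=
  FinProb.w_app_of_injective _ (aut_app_injective φ i) a

theorem IsHomogeneous.w_eq (hZ : IsHomogeneous Z) (i : H) (a : (Z.obj i).Atom) :
    (Z.obj i).w a = 1 / Fintype.card (Z.obj i).Atom := by
  have h : ∀ b, (Z.obj i).w b = (Z.obj i).w a := fun b => by
    obtain ⟨φ, rfl⟩ := hZ i a b
    exact w_app_aut φ i a
  have h1 := (Z.obj i).sum_w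
  have := (Z.obj i).atom_nonempty
  simp only [h, Finset.sum_const, Finset.card_univ, nsmul_eq_mul] at h1
  rw [eq_div_iff (by exact_mod_cast Fintype.card_ne_zero), mul_comm, h1]

end homogeneous

variable {G : Type u} [SemilatticeInf G] [OrderBot G]

theorem fromInit_bot (Z : G ⥤ FinProb.{v}) (z : (Z.obj ⊥).Atom) : fromInit Z ⊥ z = z :=
  app_map_id Z ⊥ z

open Classical in
theorem sum_condWeight_filter (Z : G ⥤ FinProb.{v}) {u : G} (a : (Z.obj u).Atom) (i : G)
    {β : Type*} (g : (Z.obj i).Atom → β) (b : β) :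
    ∑ y with g y = b, condWeight Z a i y
      = (∑ z with g (fromInit Z i z) = b ∧ fromInit Z u z = a, (Z.obj ⊥).w z) / (Z.obj u).w a := by
  simp only [condWeight, ← Finset.sum_div]
  congr 1
  have h := FinProb.sum_filter_fiberwise (fromInit Z i) (fun y => g y = b)
    (fun z => if fromInit Z u z = a then (Z.obj ⊥).w z else 0)
  simp only [← Finset.sum_filter, Finset.filter_filter] at h
  exact h

section aut
variable {Z : G ⥤ FinProb.{v}}

-- An automorphism permutes the atoms of the initial space, preserving weights and commuting with
-- all projections, so it carries the conditional law given `a` to the one given the image of `a`.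
open Classical in
theorem condWeight_aut (φ : Aut Z) {u : G} (a : (Z.obj u).Atom) (i : G) (y : (Z.obj i).Atom) :
    ∑ y' with FinProb.app (φ.hom.app i) y' = y, condWeight Z a i y'
      = condWeight Z (FinProb.app (φ.hom.app u) a) i y := by
  have hnat : ∀ j z, FinProb.app (φ.hom.app j) (fromInit Z j z)
      = fromInit Z j (FinProb.app (φ.hom.app ⊥) z) := fun j z =>
    congrArg (fun k => FinProb.app k z) (φ.hom.naturality (homOfLE (bot_le : ⊥ ≤ j)))
  have hinj : ∀ j, Function.Injective (FinProb.app (φ.hom.app j)) :=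
    aut_app_injective φ
  rw [sum_condWeight_filter, condWeight, w_app_aut]
  congr 1
  refine Finset.sum_bij (fun z _ => FinProb.app (φ.hom.app ⊥) z) ?_ (fun _ _ _ _ h => hinj _ h) ?_
    fun z _ => (w_app_aut φ ⊥ z).symm
  · intro z hz
    obtain ⟨h1, h2⟩ := (Finset.mem_filter.1 hz).2
    refine Finset.mem_filter.2 ⟨Finset.mem_univ _, ?_, ?_⟩
    · rw [← hnat, h1]
    · rw [← hnat, h2]
  · intro z hz
    obtain ⟨h1, h2⟩ := (Finset.mem_filter.1 hz).2
    obtain ⟨z', rfl⟩ := FinProb.app_surjective (φ.hom.app ⊥) z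
    refine ⟨z', Finset.mem_filter.2 ⟨Finset.mem_univ _, ?_, ?_⟩, rfl⟩
    · rw [hnat, h1]
    · exact hinj u (by rw [hnat, h2])

/-- The map of conditioned diagrams induced by an automorphism. -/
noncomputable def condAut (φ : Aut Z) {u : G} (a : (Z.obj u).Atom) :
    cond Z a ⟶ cond Z (FinProb.app (φ.hom.app u) a) where
  app i := FinProb.homOfWeights (h0 := condWeight_nonneg Z a i) (h1 := sum_condWeight Z a i)
    (k0 := condWeight_nonneg Z _ i) (k1 := sum_condWeight Z _ i) (FinProb.app (φ.hom.app i))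
    (fun b => by rw [← condWeight_aut])
  naturality i j h := by
    apply FinProb.hom_ext
    intro y
    apply FinProb.Atom.ext
    let y' : (Z.obj i).Atom := y.val
    exact congrArg (fun k => FinProb.app k y') (φ.hom.naturality h)

theorem IsHomogeneous.nonempty_cond_iso (hZ : IsHomogeneous Z) {u : G} (a b : (Z.obj u).Atom) :
    Nonempty (cond Z a ≅ cond Z b) := by
  obtain ⟨φ, rfl⟩ := hZ u a b
  have := isIso_of_injective (condAut φ a) fun i y y' h =>
    FinProb.Atom.ext (aut_app_injective φ i (congrArg FinProb.Atom.val h))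
  exact ⟨asIso (condAut φ a)⟩

end aut

/-! ### The contracted diagram -/

section contract
variable (Z : G ⥤ FinProb.{v}) {u : G} {N : ℕ} (s : Fin N → (Z.obj u).Atom)

open Classical in
/-- The joint distribution of a uniform index `n` and an atom of the initial space conditioned on
lying over `s n`. -/
noncomputable def sampleMass (p : Fin N × (Z.obj ⊥).Atom) : ℝ :=
  if fromInit Z u p.2 = s p.1 then (Z.obj ⊥).w p.2 / (Z.obj u).w (s p.1) / N else 0

theorem sampleMass_nonneg (p : Fin N × (Z.obj ⊥).Atom) : 0 ≤ sampleMass Z s p := by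
  unfold sampleMass
  split_ifs
  · exact div_nonneg (div_nonneg (FinProb.w_pos _ _).le (FinProb.w_pos _ _).le) N.cast_nonneg
  · exact le_rfl

open Classical in
theorem sum_sampleMass_filter (P : Fin N × (Z.obj ⊥).Atom → Prop) :
    ∑ p with P p, sampleMass Z s p
      = ∑ n, (∑ z with P (n, z) ∧ fromInit Z u z = s n, (Z.obj ⊥).w z) / (Z.obj u).w (s n) / N := by
  rw [Finset.sum_filter, Fintype.sum_prod_type]
  refine Finset.sum_congr rfl fun n _ => ?_
  rw [Finset.sum_div, Finset.sum_div, Finset.sum_filter]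
  refine Finset.sum_congr rfl fun z _ => ?_
  simp only [sampleMass]
  split_ifs with h1 h2 h3 h4 h5 <;> first | rfl | tauto

open Classical in
theorem sum_w_fromInit (a : (Z.obj u).Atom) :
    ∑ z with fromInit Z u z = a, (Z.obj ⊥).w z = (Z.obj u).w a :=
  FinProb.app_push (Z.map (homOfLE (bot_le : ⊥ ≤ u))) a

theorem sum_sampleMass (hN : 0 < N) : ∑ p, sampleMass Z s p = 1 := by
  classical
  have h := sum_sampleMass_filter Z s fun _ => True
  simp only [Finset.filter_true, true_and] at h
  rw [h]
  have h1 : ∀ n, (∑ z with fromInit Z u z = s n, (Z.obj ⊥).w z) / (Z.obj u).w (s n) / N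
      = (1 / N : ℝ) := fun n => by
    rw [sum_w_fromInit, div_self (FinProb.w_pos _ _).ne']
  simp_rw [h1]
  have : (N : ℝ) ≠ 0 := by exact_mod_cast hN.ne'
  simp [this]

variable (u N) in
/-- The points of the space at `i` in the contracted diagram: spaces above `u` remember the index
of the sample. -/
abbrev ContractPt (i : G) : Type v := (i ≤ u → ULift.{v} (Fin N)) × (Z.obj i).Atom

open Classical in
noncomputable instance (i : G) : Fintype (ContractPt Z u N i) := inferInstance

variable (u N) in
/-- The projection to the space at `i` in the contracted diagram. -/
noncomputable def contractPt (i : G) (p : Fin N × (Z.obj ⊥).Atom) : ContractPt Z u N i :=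
  (fun _ => ⟨p.1⟩, fromInit Z i p.2)

open Classical in
/-- The distribution of the space at `i` in the contracted diagram. -/
noncomputable def contractWeight (i : G) (a : ContractPt Z u N i) : ℝ :=
  ∑ p with contractPt Z u N i p = a, sampleMass Z s p

theorem contractWeight_nonneg (i : G) (a : ContractPt Z u N i) : 0 ≤ contractWeight Z s i a :=
  Finset.sum_nonneg fun p _ => sampleMass_nonneg Z s p

open Classical in
theorem sum_contractWeight_filter (i : G) (P : ContractPt Z u N i → Prop) :
    ∑ a with P a, contractWeight Z s i a
      = ∑ p with P (contractPt Z u N i p), sampleMass Z s p :=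
  FinProb.sum_filter_fiberwise (contractPt Z u N i) P (sampleMass Z s)

theorem sum_contractWeight (hN : 0 < N) (i : G) : ∑ a, contractWeight Z s i a = 1 := by
  classical
  have := sum_contractWeight_filter Z s i fun _ => True
  simpa [sum_sampleMass Z s hN] using this

variable {Z} in
/-- The transition maps of the contracted diagram. -/
noncomputable def contractMap {i j : G} (h : i ⟶ j) (a : ContractPt Z u N i) :
    ContractPt Z u N j :=
  (fun hj => a.1 (h.le.trans hj), FinProb.app (Z.map h) a.2)

/-- The contraction of the diagram `Z` along a sample of atoms of the space at `u`, which is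
replaced by the index set of the sample. -/
noncomputable def contract (hN : 0 < N) : G ⥤ FinProb.{v} where
  obj i := FinProb.ofWeights (contractWeight Z s i) (contractWeight_nonneg Z s i)
    (sum_contractWeight Z s hN i)
  map {i j} h := FinProb.homOfWeights (contractMap h) (fun b => by
    rw [sum_contractWeight_filter Z s i (fun a => contractMap h a = b), contractWeight]
    refine FinProb.sum_filter_congr (fun p => ?_) _
    rw [show contractMap h (contractPt Z u N i p) = contractPt Z u N j p from
      Prod.ext rfl (fromInit_map Z h p.2)])
  map_id i := FinProb.hom_ext fun x => FinProb.pt_ext (Prod.ext rfl (app_map_id Z i _))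
  map_comp f g := FinProb.hom_ext fun x => FinProb.pt_ext (Prod.ext rfl (app_map_comp Z f g _))

variable (hN : 0 < N)

variable {Z s hN} in
/-- An atom of a space in the contracted diagram as a point. -/
def cpt {i : G} (a : ((contract Z s hN).obj i).Atom) : ContractPt Z u N i := a.val

variable {Z s hN} in
theorem cpt_ext {i : G} {a b : ((contract Z s hN).obj i).Atom} (h : cpt a = cpt b) : a = b :=
  FinProb.Atom.ext h

open Classical in
theorem sum_contract_w_filter (i : G) (P : ContractPt Z u N i → Prop) :
    ∑ a with P (cpt a), ((contract Z s hN).obj i).w a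
      = ∑ p with P (contractPt Z u N i p), sampleMass Z s p := by
  rw [← sum_contractWeight_filter]
  exact FinProb.sum_atom_ofWeights (contractWeight Z s i) (contractWeight_nonneg Z s i)
    (sum_contractWeight Z s hN i) P

theorem exists_contractPt {i : G} (a : ((contract Z s hN).obj i).Atom) :
    ∃ n z, fromInit Z u z = s n ∧ contractPt Z u N i (n, z) = cpt a := by
  classical
  have h : 0 < contractWeight Z s i (cpt a) := FinProb.pt_pos (h0 := contractWeight_nonneg Z s i)
    (h1 := sum_contractWeight Z s hN i) a
  obtain ⟨⟨n, z⟩, hp, hne⟩ := Finset.exists_ne_zero_of_sum_ne_zero h.ne'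
  refine ⟨n, z, ?_, (Finset.mem_filter.1 hp).2⟩
  by_contra hz
  exact hne (if_neg hz)

/-- Two atoms of the initial space of the contracted diagram are equal if they have the same index
and the same image in `Z_x`. -/
theorem contract_bot_ext {x : G} (hfan : IsAdmissibleFan Z x u)
    {z z' : ((contract Z s hN).obj ⊥).Atom} (h1 : (cpt z).1 bot_le = (cpt z').1 bot_le)
    (h2 : fromInit Z x (cpt z).2 = fromInit Z x (cpt z').2) : z = z' := by
  obtain ⟨n, y, hy, hz⟩ := exists_contractPt Z s hN z
  obtain ⟨n', y', hy', hz'⟩ := exists_contractPt Z s hN z'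
  rw [← hz, ← hz'] at h1 h2
  have hn : n = n' := congrArg ULift.down h1
  subst hn
  refine cpt_ext ?_
  rw [← hz, ← hz']
  have : y = y' := by
    refine FinProb.injective_of_isMinimalFan hfan.minimal ?_ (hy.trans hy'.symm)
    change fromInit Z x y = fromInit Z x y'
    simpa only [contractPt, fromInit_bot] using h2
  rw [this]

/-- The new `U` carries the sample index, and an atom of the initial space is determined by its
index and its image in `X`; hence joint injectivity. -/
theorem isAdmissibleFan_contract {x : G} (hfan : IsAdmissibleFan Z x u) :
    IsAdmissibleFan (contract Z s hN) x u where
  minimal := FinProb.isMinimalFan_of_injective _ _ fun _ _ hx hu =>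
    contract_bot_ext Z s hN hfan (congrFun (congrArg (fun a => (cpt a).1) hu) le_rfl)
      (congrArg (fun a => (cpt a).2) hx)
  cover := hfan.cover

/-- The incidence relation between the atoms of `Z_u` and of `Z_x`. -/
def Incident (x : G) (a : (Z.obj u).Atom) (y : (Z.obj x).Atom) : Prop :=
  ∃ z, fromInit Z u z = a ∧ fromInit Z x z = y

-- Sending an atom of the fibre over `y` to its index is injective, and lands in the indices whose
-- sample is incident to `y`.
open Classical in
theorem condEnt_contract_le {x : G} (hfan : IsAdmissibleFan Z x u) {M : ℝ}
    (hM : ∀ y, ((Finset.univ.filter fun n => Incident Z x (s n) y).card : ℝ) ≤ M) :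
    FinProb.condEnt ((contract Z s hN).map (homOfLE (bot_le : ⊥ ≤ x))) ≤ Real.log M := by
  refine FinProb.condEnt_le_log _ fun y => le_trans ?_ (hM (cpt y).2)
  rw [← Fintype.card_subtype, ← Nat.card_eq_fintype_card]
  have hz : ∀ z : {z // FinProb.app ((contract Z s hN).map (homOfLE (bot_le : ⊥ ≤ x))) z = y},
      fromInit Z x (cpt z.1).2 = (cpt y).2 := fun z =>
    congrArg (fun a => (cpt a).2) z.2
  have hR : ∀ z : {z // FinProb.app ((contract Z s hN).map (homOfLE (bot_le : ⊥ ≤ x))) z = y},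
      Incident Z x (s ((cpt z.1).1 bot_le).down) (cpt y).2 := by
    intro z
    obtain ⟨n, z', h1, h2⟩ := exists_contractPt Z s hN z.1
    refine ⟨z', ?_, ?_⟩
    · rw [h1, ← h2]
      rfl
    · rw [← hz z, ← h2]
      simp only [contractPt, fromInit_bot]
  exact_mod_cast Nat.card_le_card_of_injective
    (fun z => (⟨((cpt z.1).1 bot_le).down, hR z⟩ : {n // Incident Z x (s n) (cpt y).2}))
    fun z z' h => Subtype.ext <| contract_bot_ext Z s hN hfan
      (ULift.ext _ _ (congrArg Subtype.val h)) ((hz z).trans (hz z').symm)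

section conditioned
variable (n : Fin N) (a : ((contract Z s hN).obj u).Atom)

-- Conditioning on the atom `a` fixes the index, even if `s` repeats a value, so only the `n`-th
-- summand of the sampling law survives, and the factors `1 / N` cancel.
open Classical in
theorem condWeight_contract (ha : cpt a = (fun _ => ⟨n⟩, s n)) (i : G) (y : (Z.obj i).Atom) :
    ∑ y' with (cpt y').2 = y, condWeight (contract Z s hN) a i y' = condWeight Z (s n) i y := by
  have hN' : (N : ℝ) ≠ 0 := by exact_mod_cast hN.ne'
  have key : ∀ P : (Z.obj ⊥).Atom → Prop,
      ∑ z : ((contract Z s hN).obj ⊥).Atom with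
        P (cpt z).2 ∧ fromInit (contract Z s hN) u z = a, ((contract Z s hN).obj ⊥).w z
      = (∑ z with P z ∧ fromInit Z u z = s n, (Z.obj ⊥).w z) / (Z.obj u).w (s n) / N := by
    intro P
    have h1 := sum_contract_w_filter Z s hN ⊥ fun b => P b.2 ∧
      (fun h => b.1 (bot_le.trans h), fromInit Z u b.2) = cpt a
    have h2 : ∀ z : ((contract Z s hN).obj ⊥).Atom, fromInit (contract Z s hN) u z = a ↔
        (fun h => (cpt z).1 (bot_le.trans h), fromInit Z u (cpt z).2) = cpt a := fun z =>
      ⟨fun h => congrArg cpt h, fun h => cpt_ext h⟩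
    refine (FinProb.sum_filter_congr (fun z => and_congr_right' (h2 z)) _).trans (h1.trans ?_)
    rw [sum_sampleMass_filter, Finset.sum_eq_single n]
    · congr 3
      ext z
      simp only [Finset.mem_filter, Finset.mem_univ, true_and, contractPt, fromInit_bot, ha,
        Prod.mk.injEq, and_assoc, and_self]
    · intro m _ hm
      rw [Finset.sum_eq_zero, zero_div, zero_div]
      intro z hz
      simp only [Finset.mem_filter] at hz
      have h3 := hz.2.1.2
      rw [ha] at h3
      exact absurd (congrArg ULift.down (congrFun (congrArg Prod.fst h3) le_rfl)) hm
    · simp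
  have hwa : ((contract Z s hN).obj u).w a = 1 / N := by
    have h1 := key fun _ => True
    simp only [true_and] at h1
    rw [sum_w_fromInit, sum_w_fromInit, div_self (FinProb.w_pos _ _).ne'] at h1
    exact h1
  have h1 := sum_condWeight_filter (contract Z s hN) a i (fun y' => (cpt y').2) y
  rw [h1, hwa, condWeight]
  refine (congrArg (· / (1 / (N : ℝ))) (Eq.trans ?_ (key fun z => fromInit Z i z = y))).trans ?_
  · exact FinProb.sum_filter_congr (fun z => Iff.rfl) _
  · field_simp

/-- Conditioning the contracted diagram on a sample index maps to conditioning the diagram on the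
sample. -/
noncomputable def condContract (ha : cpt a = (fun _ => ⟨n⟩, s n)) :
    cond (contract Z s hN) a ⟶ cond Z (s n) where
  app i := FinProb.homOfWeights (h0 := condWeight_nonneg _ a i) (h1 := sum_condWeight _ a i)
    (k0 := condWeight_nonneg Z _ i) (k1 := sum_condWeight Z _ i) (fun y => (cpt y).2)
    (fun b => by rw [← condWeight_contract Z s hN n a ha])
  naturality i j h := rfl

/-- Since `x` is not below `u`, neither is any descendant of `x`. The index component there is a
function on an empty type, so forgetting it is injective. -/
theorem nonempty_ideal_cond_contract_iso {x : G} (hxu : ¬ x ≤ u) :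
    ∃ n, Nonempty (ideal (cond (contract Z s hN) a) x ≅ ideal (cond Z (s n)) x) := by
  obtain ⟨n, z, h1, h2⟩ := exists_contractPt Z s hN a
  have ha : cpt a = (fun _ => ⟨n⟩, s n) := by rw [← h2, contractPt, h1]
  let f : ideal (cond (contract Z s hN) a) x ⟶ ideal (cond Z (s n)) x :=
    Functor.whiskerLeft _ (condContract Z s hN n a ha)
  have := isIso_of_injective f fun i y y' h => by
    let b : ((contract Z s hN).obj i.1).Atom := y.val
    let b' : ((contract Z s hN).obj i.1).Atom := y'.val
    have hb : (cpt b).2 = (cpt b').2 := congrArg FinProb.Atom.val h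
    refine FinProb.Atom.ext (cpt_ext (a := b) (b := b') (Prod.ext ?_ hb))
    exact funext fun hi => absurd (i.2.trans hi) hxu
  exact ⟨n, ⟨asIso f⟩⟩

end conditioned

end contract

end ProbDiag

namespace ProbDiag

variable {G : Type u} [SemilatticeInf G] [OrderBot G] {Z : G ⥤ FinProb.{v}} {x u : G}

/-! ### Incidence counts and domination by the original diagram -/

section incidence

open Classical in
/-- In a homogeneous diagram with an admissible fan, every atom of `Z_x` is incident to the same
proportion of the atoms of `Z_u`. -/
theorem IsHomogeneous.card_incident (hZ : IsHomogeneous Z) (hfan : IsAdmissibleFan Z x u)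
    (y : (Z.obj x).Atom) :
    ((Finset.univ.filter fun a : (Z.obj u).Atom => Incident Z x a y).card : ℝ)
      = Fintype.card (Z.obj ⊥).Atom / Fintype.card (Z.obj x).Atom := by
  have h1 : (Finset.univ.filter fun a : (Z.obj u).Atom => Incident Z x a y)
      = (Finset.univ.filter fun z => fromInit Z x z = y).image (fromInit Z u) := by
    ext a
    rw [Finset.mem_filter, Finset.mem_image]
    constructor
    · rintro ⟨-, z, h, h'⟩
      exact ⟨z, Finset.mem_filter.2 ⟨Finset.mem_univ _, h'⟩, h⟩
    · rintro ⟨z, hz, h⟩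
      exact ⟨Finset.mem_univ _, z, h, (Finset.mem_filter.1 hz).2⟩
  have h2 := sum_w_fromInit Z y
  have := (Z.obj ⊥).atom_nonempty
  have := (Z.obj x).atom_nonempty
  have hb : (Fintype.card (Z.obj ⊥).Atom : ℝ) ≠ 0 := by exact_mod_cast Fintype.card_ne_zero
  have hx : (Fintype.card (Z.obj x).Atom : ℝ) ≠ 0 := by exact_mod_cast Fintype.card_ne_zero
  simp only [hZ.w_eq, Finset.sum_const, nsmul_eq_mul] at h2
  -- By minimality the fibre over `y` embeds in the atoms of `Z_u`; uniform weights give its size.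
  rw [h1, Finset.card_image_of_injOn]
  · field_simp at h2 ⊢
    linarith
  · intro z hz z' hz' h
    exact FinProb.injective_of_isMinimalFan hfan.minimal
      ((Finset.mem_filter.1 hz).2.trans (Finset.mem_filter.1 hz').2.symm) h

-- By minimality at most one atom of the initial space lies over the pair `(y, a)`, and the weights
-- are uniform.
open Classical in
theorem IsHomogeneous.sum_fiber_div (hZ : IsHomogeneous Z) (hfan : IsAdmissibleFan Z x u)
    (a : (Z.obj u).Atom) (y : (Z.obj x).Atom) :
    (∑ z with fromInit Z x z = y ∧ fromInit Z u z = a, (Z.obj ⊥).w z) / (Z.obj u).w a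
      = if Incident Z x a y then
          (Fintype.card (Z.obj u).Atom : ℝ) / Fintype.card (Z.obj ⊥).Atom else 0 := by
  split_ifs with h
  · obtain ⟨z, rfl, rfl⟩ := h
    rw [Finset.sum_eq_single_of_mem z (by simp), hZ.w_eq, hZ.w_eq, div_div_div_eq, one_mul, mul_one]
    intro z' hz' hne
    obtain ⟨h1, h2⟩ := (Finset.mem_filter.1 hz').2
    exact absurd (FinProb.injective_of_isMinimalFan hfan.minimal h1 h2) hne
  · rw [Finset.sum_eq_zero, zero_div]
    intro z hz
    obtain ⟨h1, h2⟩ := (Finset.mem_filter.1 hz).2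
    exact absurd ⟨z, h2, h1⟩ h

end incidence

section distance
variable {N : ℕ} (s : Fin N → (Z.obj u).Atom) (hN : 0 < N)

/-- The comparison of the contracted diagram with the original one. -/
def forget (i : {i : G // x ≤ i}) (a : ((ideal (contract Z s hN) x).obj i).Atom) :
    ((ideal Z x).obj i).Atom :=
  (cpt (Z := Z) (s := s) (hN := hN) (i := i.1) a).2

theorem forget_map {i j : {i : G // x ≤ i}} (h : i ⟶ j)
    (a : ((ideal (contract Z s hN) x).obj i).Atom) :
    forget s hN j (FinProb.app ((ideal (contract Z s hN) x).map h) a)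
      = FinProb.app ((ideal Z x).map h) (forget s hN i a) := rfl

theorem forget_injective (hxu : ¬ x ≤ u) (i : {i : G // x ≤ i}) :
    Function.Injective (forget (Z := Z) (x := x) s hN i) := fun a b h =>
  cpt_ext (a := a) (b := b) (Prod.ext (funext fun hi => absurd (i.2.trans hi) hxu) h)

-- Excess is pushed forward by the transition maps, so nonnegativity need only be checked at `x`.
-- There the contracted mass of `y` is its number of hits times `|U| / (|Z₀| N)`, which `ht`
-- compares with the uniform weight.
open Classical in
theorem excess_forget_nonneg (hZ : IsHomogeneous Z) (hfan : IsAdmissibleFan Z x u) {t : ℝ}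
    (ht : ∀ y, t * (Finset.univ.filter fun n => Incident Z x (s n) y).card
      ≤ N * ((Fintype.card (Z.obj ⊥).Atom : ℝ)
        / Fintype.card (Z.obj x).Atom / Fintype.card (Z.obj u).Atom))
    (i : {i : G // x ≤ i}) (a : ((ideal Z x).obj i).Atom) :
    0 ≤ excess (X := ideal Z x) (forget s hN) t i a := by
  have hx : ∀ y : ((ideal Z x).obj ⟨x, le_rfl⟩).Atom,
      0 ≤ excess (X := ideal Z x) (forget s hN) t ⟨x, le_rfl⟩ y := by
    intro y
    let y₀ : (Z.obj x).Atom := y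
    have h1 : ∑ b with forget (x := x) s hN ⟨x, le_rfl⟩ b = y,
        ((ideal (contract Z s hN) x).obj ⟨x, le_rfl⟩).w b
        = (Finset.univ.filter fun n => Incident Z x (s n) y₀).card
          * ((Fintype.card (Z.obj u).Atom : ℝ) / Fintype.card (Z.obj ⊥).Atom) / N := by
      refine (sum_contract_w_filter Z s hN x (fun b => b.2 = y₀)).trans ?_
      rw [sum_sampleMass_filter, ← Finset.sum_div]
      congr 1
      rw [← nsmul_eq_mul, ← Finset.sum_const, Finset.sum_filter]
      exact Finset.sum_congr rfl fun n _ => hZ.sum_fiber_div hfan (s n) y₀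
    have h2 : ((ideal Z x).obj ⟨x, le_rfl⟩).w y = 1 / Fintype.card (Z.obj x).Atom :=
      hZ.w_eq x y₀
    have := (Z.obj ⊥).atom_nonempty
    have := (Z.obj x).atom_nonempty
    have := (Z.obj u).atom_nonempty
    have hb : (0 : ℝ) < Fintype.card (Z.obj ⊥).Atom := by exact_mod_cast Fintype.card_pos
    have hx : (0 : ℝ) < Fintype.card (Z.obj x).Atom := by exact_mod_cast Fintype.card_pos
    have hu : (0 : ℝ) < Fintype.card (Z.obj u).Atom := by exact_mod_cast Fintype.card_pos
    have hn : (0 : ℝ) < N := by exact_mod_cast hN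
    rw [excess, h1, h2, sub_nonneg]
    have h3 := mul_le_mul_of_nonneg_right (ht y₀)
      (by positivity : 0 ≤ (Fintype.card (Z.obj u).Atom : ℝ) / Fintype.card (Z.obj ⊥).Atom / N)
    refine le_trans (le_of_eq ?_) (h3.trans (le_of_eq ?_))
    · ring
    · field_simp
  rw [← excess_push (forget_map s hN)
    (homOfLE i.2 : (⟨x, le_rfl⟩ : {i : G // x ≤ i}) ⟶ i)]
  exact Finset.sum_nonneg fun y _ => hx y

end distance

/-- Here the map to `U` factors through `X`, so minimality alone makes `Z₀ ⟶ X` injective. -/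
theorem condEnt_nonpos_of_le (hfan : IsAdmissibleFan Z x u) (hxu : x ≤ u) :
    FinProb.condEnt (Z.map (homOfLE (bot_le : ⊥ ≤ x))) ≤ 0 := by
  rw [← Real.log_one]
  refine FinProb.condEnt_le_log _ fun y => ?_
  have : Subsingleton {z // FinProb.app (Z.map (homOfLE (bot_le : ⊥ ≤ x))) z = y} :=
    ⟨fun z z' => Subtype.ext <| FinProb.injective_of_isMinimalFan hfan.minimal
      (z.2.trans z'.2.symm) <| by
        have h := fromInit_map Z (homOfLE hxu)
        exact (h z.1).symm.trans ((congrArg _ (z.2.trans z'.2.symm)).trans (h z'.1))⟩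
  exact_mod_cast Finite.card_le_one_iff_subsingleton.2 this

end ProbDiag

/-! ### The proposition -/

/-- Arrow contraction for a homogeneous diagram of probability spaces. -/
theorem propositionp {G : Type u} [SemilatticeInf G] [OrderBot G] [Fintype G]
    (Z : G ⥤ FinProb.{v}) (hZ : ProbDiag.IsHomogeneous Z) (x u : G)
    (hfan : ProbDiag.IsAdmissibleFan Z x u)
    (hcard : 3 ≤ Fintype.card (Z.obj x).Atom) :
    ∃ Z' : G ⥤ FinProb.{v}, ProbDiag.IsAdmissibleFan Z' x u ∧
      (∀ (a : (Z.obj u).Atom) (a' : (Z'.obj u).Atom),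
        Nonempty (ProbDiag.ideal (ProbDiag.cond Z a) x ≅
          ProbDiag.ideal (ProbDiag.cond Z' a') x)) ∧
      (∃ d : ℝ, ProbDiag.IsAikd (ProbDiag.ideal Z x) (ProbDiag.ideal Z' x) d ∧
        d ≤ ProbDiag.ikd (ProbDiag.ideal Z x) (ProbDiag.ideal Z' x)) ∧
      ProbDiag.ikd (ProbDiag.ideal Z x) (ProbDiag.ideal Z' x) ≤ 20 * Fintype.card G ∧
      FinProb.condEnt (Z'.map (homOfLE (bot_le : ⊥ ≤ x))) ≤
        4 * Real.log (Real.log (Fintype.card (Z.obj x).Atom)) := by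
  classical
  have hcard' : (3 : ℝ) ≤ Fintype.card (Z.obj x).Atom := by exact_mod_cast hcard
  have hL : 1 ≤ Real.log (Fintype.card (Z.obj x).Atom) := by
    rw [Real.le_log_iff_exp_le (by linarith)]
    exact (Real.exp_one_lt_d9.le.trans (by norm_num)).trans hcard'
  have hideal : ∀ a b : (Z.obj u).Atom,
      Nonempty (ProbDiag.ideal (ProbDiag.cond Z a) x ≅ ProbDiag.ideal (ProbDiag.cond Z b) x) :=
    fun a b => (hZ.nonempty_cond_iso a b).map fun e => Functor.isoWhiskerLeft _ e
  by_cases hxu : x ≤ u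
  · refine ⟨Z, hfan, hideal, ProbDiag.exists_isAikd _ _, ?_, ?_⟩
    · rw [ProbDiag.ikd_self]
      positivity
    · exact (ProbDiag.condEnt_nonpos_of_le hfan hxu).trans
        (mul_nonneg (by norm_num) (Real.log_nonneg hL))
  have := (Z.obj ⊥).atom_nonempty
  have := (Z.obj x).atom_nonempty
  have := (Z.obj u).atom_nonempty
  have hb : (0 : ℝ) < Fintype.card (Z.obj ⊥).Atom := by exact_mod_cast Fintype.card_pos
  have hx : (0 : ℝ) < Fintype.card (Z.obj x).Atom := by exact_mod_cast Fintype.card_pos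
  have hu : (0 : ℝ) < Fintype.card (Z.obj u).Atom := by exact_mod_cast Fintype.card_pos
  have hinc := hZ.card_incident hfan
  obtain ⟨N, s, t, hN, ht, ht1, htL, hM, hs⟩ := exists_sample
    (ProbDiag.Incident Z (u := u) x)
    (q := (Fintype.card (Z.obj ⊥).Atom : ℝ) / Fintype.card (Z.obj x).Atom
      / Fintype.card (Z.obj u).Atom) (by positivity)
    (by
      obtain ⟨y⟩ := (Z.obj x).atom_nonempty
      -- `|Z₀| / |X|` counts the atoms of `U` incident to `y`, so it is at most `|U|`.
      rw [div_le_one hu, ← hinc y]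
      exact_mod_cast Finset.card_le_univ _)
    (by
      rw [div_right_comm]
      have : (Fintype.card (Z.obj u).Atom : ℝ) ≤ Fintype.card (Z.obj ⊥).Atom := by
        exact_mod_cast FinProb.card_atom_le (Z.map (homOfLE (bot_le : ⊥ ≤ u)))
      have := (one_le_div hu).2 this
      gcongr)
    (fun y => by rw [hinc y, div_mul_cancel₀ _ hu.ne']) hcard
  refine ⟨ProbDiag.contract Z s hN, ProbDiag.isAdmissibleFan_contract Z s hN hfan, fun a a' => ?_,
    ProbDiag.exists_isAikd _ _, ?_, ?_⟩
  · obtain ⟨n, ⟨e⟩⟩ := ProbDiag.nonempty_ideal_cond_contract_iso Z s hN a' hxu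
    exact (hideal a (s n)).map fun e' => e' ≪≫ e.symm
  · refine (ProbDiag.ikd_le_of_excess_nonneg (e := ProbDiag.forget s hN)
      (ProbDiag.forget_map s hN) ht ht1 (ProbDiag.excess_forget_nonneg s hN hZ hfan hs)
      (ProbDiag.forget_injective s hN hxu) (M := Fintype.card (Z.obj x).Atom) fun i => ?_).trans ?_
    · exact_mod_cast FinProb.card_atom_le (Z.map (homOfLE i.2))
    · have h1 : (Fintype.card {i : G // x ≤ i} : ℝ) ≤ Fintype.card G := by
        exact_mod_cast Fintype.card_subtype_le _
      rw [mul_comm (20 : ℝ)]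
      -- The constant is `20 = 2 * (1 + 9)`, with `9` the bound `htL` on `(1 - t) * log |X|`.
      refine mul_le_mul h1 (by linarith) ?_ (Nat.cast_nonneg _)
      have := mul_nonneg (sub_nonneg.2 ht1.le) (zero_le_one.trans hL)
      linarith
  · refine (ProbDiag.condEnt_contract_le Z s hN hfan hM).trans (le_of_eq ?_)
    rw [Real.log_pow]
    norm_num
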